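/- Let $n\ge 1$ and let $(M,\omega)$ be an $n$-plectic manifold: $M$ is a smooth manifold and $\omega\in\Omega^{n+1}(M)$ is a closed form such that $v\mapsto v\lrcorner\omega$ is injective on every tangent space $T_xM$. Let $G$ be a connected Lie group with Lie algebra $\mathfrak g$ that acts smoothly on $M$ and multisymplectically, i.e. $\Phi_g^*\omega=\omega$ for all $g\in G$, where $\Phi_g(x)=g\cdot x$. *Notation.* For $\xi\in\mathfrak g$ let $V_\xi$ be the infinitesimal generator, $V_\xi(x)=\frac{d}{dt}\big|_{t=0}\exp(t\xi)\cdot x$; for $p=\xi_1\wedge\dots\wedge\xi_k$ put $V_p=V_{\xi_1}\wedge\dots\wedge V_{\xi_k}$ and extend linearly to $p\in\Lambda^k\mathfrak g$. For a $k$-vector field, $(X_1\wedge\dots\wedge X_k)\lrcorner\tau=\tau(X_1,\dots,X_k,\cdot,\dots,\cdot)$, extended linearly. The $k$-th Lie kernel $\mathcal P_{\mathfrak g,k}\subset\Lambda^k\mathfrak g$ is the kernel of $$\partial_k(\xi_1\wedge\dots\wedge\xi_k)=\sum_{i<j}(-1)^{i+j}[\xi_i,\xi_j]\wedge\xi_1\wedge\dots\wedge\widehat{\xi_i}\wedge\dots\wedge\widehat{\xi_j}\wedge\dots\wedge\xi_k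 .$$ It is invariant under the adjoint action $\mathrm{ad}_\xi(\eta_1\wedge\dots\wedge\eta_k)=\sum_i\eta_1\wedge\dots\wedge[\xi,\eta_i]\wedge\dots\wedge\eta_k$. The Lie algebra $\mathfrak g$ acts on $\mathcal P_{\mathfrak g,k}^*$ by $(\xi\cdot c)(p)=-c(\mathrm{ad}_\xi p)$, on the space $\Omega^{m}_{\mathrm{cl}}$ of closed $m$-forms on $M$ by $\xi\cdot\alpha=-\mathcal L_{V_\xi}\alpha$, and on $\mathcal P_{\mathfrak g,k}^*\otimes\Omega^{m}_{\mathrm{cl}}$ by the tensor product of these actions. For a $\mathfrak g$-module $R$, $H^0(\mathfrak g,R)=\{r\in R:\ \xi\cdot r=0\text{ for all }\xi\in\mathfrak g\}$. For $1\le k\le n$ let $\Omega^{n-k}_{\mathrm{Ham}}(M)$ be the set of $\alpha\in\Omega^{n-k}(M)$ for which there is a smooth $k$-vector field $X$ with $d\alpha=-X\lrcorner\omega$. A (not necessarily equivariant) weak $k$-moment map is a linear map $f_k:\mathcal P_{\mathfrak g,k}\to\Omega^{n-k}_{\mathrm{Ham}}(M)$ with $$d f_k(p)=-\zeta(k)\,V_p\lrcorner\omega\quad\text{for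 all }p\in\mathcal P_{\mathfrak g,k},\qquad \zeta(k)=-(-1)^{k(k+1)/2}.$$ A (not necessarily equivariant) full weak moment map is a collection of weak $k$-moment maps $f_k$, one for each $1\le k\le n$. *Theorem.* 1. If $1\le k\le n$ and $H^0(\mathfrak g,\mathcal P_{\mathfrak g,k}^*)=0$, then a weak $k$-moment map exists. If $H^0(\mathfrak g,\mathcal P_{\mathfrak g,k}^*)=0$ for all $1\le k\le n$, then a full weak moment map exists. 2. If $1\le k\le n$, $H^0(\mathfrak g,\mathcal P_{\mathfrak g,k}^*\otimes\Omega^{n-k}_{\mathrm{cl}})=0$ and $H^0(\mathfrak g,\Omega^{n-k}_{\mathrm{cl}})\neq 0$, then a weak $k$-moment map exists. If these two conditions hold for all $1\le k\le n$, then a full weak moment map exists. -/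

import Mathlib

open scoped Manifold ContDiff
noncomputable section
namespace Multisymplectic

section Algebra
variable {L : Type*} [LieRing L] [LieAlgebra ℝ L]

theorem exteriorAlgebra_left_induction {P : ExteriorAlgebra ℝ L → Prop}
    (algebraMap : ∀ r : ℝ, P (algebraMap ℝ (ExteriorAlgebra ℝ L) r))
    (add : ∀ x y, P x → P y → P (x + y))
    (ι_mul : ∀ x m, P x → P (ExteriorAlgebra.ι ℝ m * x)) (x : ExteriorAlgebra ℝ L) : P x :=
  CliffordAlgebra.left_induction (0 : QuadraticForm ℝ L) algebraMap add ι_mul x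

/-- The derivation of the exterior algebra of `L` that extends `η ↦ ⁅ξ, η⁆`, defined by the
recursion `adExtAux_one`, `adExtAux_ι_mul`. -/
def adExtAux (ξ : L) : ExteriorAlgebra ℝ L →ₗ[ℝ] ExteriorAlgebra ℝ L :=
  CliffordAlgebra.foldr' (0 : QuadraticForm ℝ L)
    (LinearMap.mk₂ ℝ
      (fun (η : L) (z : ExteriorAlgebra ℝ L × ExteriorAlgebra ℝ L) =>
        ExteriorAlgebra.ι ℝ ⁅ξ, η⁆ * z.1 + ExteriorAlgebra.ι ℝ η * z.2)
      (by intro a b z; simp only [lie_add, map_add, add_mul]; abel)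
      (by intro c a z; simp)
      (by intro a z w; simp only [Prod.fst_add, Prod.snd_add, mul_add]; abel)
      (by intro c a z; simp))
    (by
      intro m x y
      have h1 : ExteriorAlgebra.ι ℝ m * (ExteriorAlgebra.ι ℝ m * y) = 0 := by
        rw [← mul_assoc, ExteriorAlgebra.ι_sq_zero, zero_mul]
      have h2 : ExteriorAlgebra.ι ℝ ⁅ξ, m⁆ * (ExteriorAlgebra.ι ℝ m * x) +
          ExteriorAlgebra.ι ℝ m * (ExteriorAlgebra.ι ℝ ⁅ξ, m⁆ * x) = 0 := by
        rw [← mul_assoc, ← mul_assoc, ← add_mul, ExteriorAlgebra.ι_add_mul_swap, zero_mul]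
      simp only [LinearMap.mk₂_apply, mul_add, h1, add_zero, _root_.zero_apply, zero_smul]
      exact h2)
    0

theorem adExtAux_algebraMap (ξ : L) (r : ℝ) :
    adExtAux ξ (algebraMap ℝ (ExteriorAlgebra ℝ L) r) = 0 :=
  (CliffordAlgebra.foldr'_algebraMap (0 : QuadraticForm ℝ L) _ _ _ r).trans (smul_zero _)

theorem adExtAux_ι_mul (ξ η : L) (x : ExteriorAlgebra ℝ L) :
    adExtAux ξ (ExteriorAlgebra.ι ℝ η * x) =
      ExteriorAlgebra.ι ℝ ⁅ξ, η⁆ * x + ExteriorAlgebra.ι ℝ η * adExtAux ξ x :=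
  CliffordAlgebra.foldr'_ι_mul _ _ _ _ _ _

/-- The extended adjoint action of `L` on its exterior algebra,
`ad_ξ (η₁ ∧ ⋯ ∧ ηₖ) = ∑ᵢ η₁ ∧ ⋯ ∧ ⁅ξ, ηᵢ⁆ ∧ ⋯ ∧ ηₖ` (see `adExt_ιMulti`). -/
def adExt : L →ₗ[ℝ] ExteriorAlgebra ℝ L →ₗ[ℝ] ExteriorAlgebra ℝ L where
  toFun := adExtAux
  map_add' a b := by
    refine LinearMap.ext fun x => ?_
    induction x using exteriorAlgebra_left_induction with
    | algebraMap r => simp only [LinearMap.add_apply, adExtAux_algebraMap, add_zero]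
    | add x y hx hy => simp only [map_add, hx, hy]
    | ι_mul x m hx =>
      simp only [LinearMap.add_apply] at hx ⊢
      simp only [adExtAux_ι_mul, hx, add_lie, map_add, add_mul, mul_add]
      abel
  map_smul' c a := by
    refine LinearMap.ext fun x => ?_
    induction x using exteriorAlgebra_left_induction with
    | algebraMap r =>
      simp only [LinearMap.smul_apply, RingHom.id_apply, adExtAux_algebraMap, smul_zero]
    | add x y hx hy => simp only [map_add, hx, hy]
    | ι_mul x m hx =>
      simp only [LinearMap.smul_apply, RingHom.id_apply] at hx ⊢
      simp only [adExtAux_ι_mul, hx, smul_lie, map_smul, smul_mul_assoc, mul_smul_comm, smul_add]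

theorem adExt_algebraMap (ξ : L) (r : ℝ) :
    adExt ξ (algebraMap ℝ (ExteriorAlgebra ℝ L) r) = 0 :=
  adExtAux_algebraMap ξ r

theorem adExt_ι_mul (ξ η : L) (x : ExteriorAlgebra ℝ L) :
    adExt ξ (ExteriorAlgebra.ι ℝ η * x) =
      ExteriorAlgebra.ι ℝ ⁅ξ, η⁆ * x + ExteriorAlgebra.ι ℝ η * adExt ξ x :=
  adExtAux_ι_mul ξ η x

/-- The Chevalley–Eilenberg differential of the exterior algebra of `L`, defined by the recursion
`∂ 1 = 0`, `∂ (η ∧ x) = - η ∧ ∂ x - ad_η x`. On decomposable elements it is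
`∂ (ξ₁ ∧ ⋯ ∧ ξₖ) = ∑_{i<j} (-1)^{i+j} ⁅ξᵢ, ξⱼ⁆ ∧ ξ₁ ∧ ⋯ ∧ ξ̂ᵢ ∧ ⋯ ∧ ξ̂ⱼ ∧ ⋯ ∧ ξₖ`
(see `ceDiff_ιMulti`). -/
def ceDiff : ExteriorAlgebra ℝ L →ₗ[ℝ] ExteriorAlgebra ℝ L :=
  CliffordAlgebra.foldr' (0 : QuadraticForm ℝ L)
    (LinearMap.mk₂ ℝ
      (fun (η : L) (z : ExteriorAlgebra ℝ L × ExteriorAlgebra ℝ L) =>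
        -(ExteriorAlgebra.ι ℝ η * z.2) - adExt η z.1)
      (by intro a b z; simp only [map_add, add_mul, LinearMap.add_apply]; abel)
      (by intro c a z; simp [smul_sub])
      (by intro a z w; simp only [Prod.fst_add, Prod.snd_add, mul_add, map_add]; abel)
      (by intro c a z; simp [smul_sub]))
    (by
      intro m x y
      have h1 : ExteriorAlgebra.ι ℝ m * (ExteriorAlgebra.ι ℝ m * y) = 0 := by
        rw [← mul_assoc, ExteriorAlgebra.ι_sq_zero, zero_mul]
      have h2 := adExt_ι_mul m m x
      rw [lie_self, map_zero, zero_mul, zero_add] at h2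
      simp only [LinearMap.mk₂_apply, mul_sub, mul_neg, h1, _root_.zero_apply, zero_smul]
      erw [h2]
      simp)
    0

theorem ceDiff_algebraMap (r : ℝ) :
    ceDiff (algebraMap ℝ (ExteriorAlgebra ℝ L) r) = 0 :=
  (CliffordAlgebra.foldr'_algebraMap (0 : QuadraticForm ℝ L) _ _ _ r).trans (smul_zero _)

theorem ceDiff_ι_mul (η : L) (x : ExteriorAlgebra ℝ L) :
    ceDiff (ExteriorAlgebra.ι ℝ η * x) = -(ExteriorAlgebra.ι ℝ η * ceDiff x) - adExt η x :=
  CliffordAlgebra.foldr'_ι_mul _ _ _ _ _ _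

theorem adExt_lie (ξ η : L) (x : ExteriorAlgebra ℝ L) :
    adExt ⁅ξ, η⁆ x = adExt ξ (adExt η x) - adExt η (adExt ξ x) := by
  induction x using exteriorAlgebra_left_induction with
  | algebraMap r => simp only [adExt_algebraMap, map_zero, sub_zero]
  | add x y hx hy => simp only [map_add, hx, hy]; abel
  | ι_mul x m hx =>
    simp only [adExt_ι_mul, map_add, hx, lie_lie, map_sub, sub_mul, mul_sub]
    abel

theorem ceDiff_adExt (ξ : L) (x : ExteriorAlgebra ℝ L) :
    ceDiff (adExt ξ x) = adExt ξ (ceDiff x) := by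
  induction x using exteriorAlgebra_left_induction with
  | algebraMap r => simp only [adExt_algebraMap, ceDiff_algebraMap, map_zero]
  | add x y hx hy => simp only [map_add, hx, hy]
  | ι_mul x m hx =>
    simp only [adExt_ι_mul, ceDiff_ι_mul, map_add, map_sub, map_neg, hx, adExt_lie]
    abel

/-- The extended adjoint action on decomposable elements. -/
theorem adExt_ιMulti (ξ : L) (k : ℕ) (v : Fin k → L) :
    adExt ξ (ExteriorAlgebra.ιMulti ℝ k v) =
      ∑ i, ExteriorAlgebra.ιMulti ℝ k (Function.update v i ⁅ξ, v i⁆) := by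
  induction k with
  | zero => simpa using! adExt_algebraMap ξ 1
  | succ k ih =>
    rw [ExteriorAlgebra.ιMulti_succ_apply, adExt_ι_mul, ih, Fin.sum_univ_succ, Finset.mul_sum]
    congr 1
    · rw [ExteriorAlgebra.ιMulti_succ_apply]
      simp [Matrix.vecTail, Function.comp_def]
    · refine Finset.sum_congr rfl fun i _ => ?_
      rw [ExteriorAlgebra.ιMulti_succ_apply, Function.update_of_ne (Fin.succ_ne_zero i).symm]
      congr 2
      ext j
      by_cases h : j = i
      · subst h; simp [Matrix.vecTail]
      · simp [Matrix.vecTail, h]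

theorem ι_mul_ι_mul_swap (a b : L) (x : ExteriorAlgebra ℝ L) :
    ExteriorAlgebra.ι ℝ a * (ExteriorAlgebra.ι ℝ b * x) =
      -(ExteriorAlgebra.ι ℝ b * (ExteriorAlgebra.ι ℝ a * x)) := by
  rw [← mul_assoc, ← mul_assoc, ← neg_mul,
    eq_neg_of_add_eq_zero_left (ExteriorAlgebra.ι_add_mul_swap (R := ℝ) a b)]

theorem ιMulti_removeNth_succ (k : ℕ) (v : Fin (k + 2) → L) (i : Fin (k + 1)) :
    ExteriorAlgebra.ιMulti ℝ (k + 1) (i.succ.removeNth v) =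
      ExteriorAlgebra.ι ℝ (v 0) *
        ExteriorAlgebra.ιMulti ℝ k (i.removeNth (Matrix.vecTail v)) := by
  rw [ExteriorAlgebra.ιMulti_succ_apply]
  congr 3
  ext j
  simp [Fin.removeNth, Matrix.vecTail]

theorem adExt_ιMulti' (ξ : L) (k : ℕ) (v : Fin (k + 1) → L) :
    adExt ξ (ExteriorAlgebra.ιMulti ℝ (k + 1) v) =
      ∑ i : Fin (k + 1), (-1 : ℝ) ^ (i : ℕ) •
        (ExteriorAlgebra.ι ℝ ⁅ξ, v i⁆ * ExteriorAlgebra.ιMulti ℝ k (i.removeNth v)) := by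
  induction k with
  | zero =>
    rw [ExteriorAlgebra.ιMulti_succ_apply, adExt_ι_mul]
    have : adExt ξ (1 : ExteriorAlgebra ℝ L) = 0 := by simpa using! adExt_algebraMap ξ 1
    simp [this]
  | succ k ih =>
    rw [ExteriorAlgebra.ιMulti_succ_apply, adExt_ι_mul, ih, Finset.mul_sum, Fin.sum_univ_succ
      (fun i : Fin (k + 1 + 1) => (-1 : ℝ) ^ (i : ℕ) •
        (ExteriorAlgebra.ι ℝ ⁅ξ, v i⁆ * ExteriorAlgebra.ιMulti ℝ (k + 1) (i.removeNth v)))]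
    congr 1
    · simp only [Fin.val_zero, pow_zero, one_smul, Fin.removeNth_zero]
      rfl
    · refine Finset.sum_congr rfl fun i _ => ?_
      rw [ιMulti_removeNth_succ, ι_mul_ι_mul_swap, Fin.val_succ, pow_succ, mul_neg_one, neg_smul,
        smul_neg, neg_neg, mul_smul_comm]
      rfl

/-- The Chevalley–Eilenberg differential on decomposable elements; the indices `i ≤ j` stand for
the positions `i` and `j + 1` of the two omitted factors, counted from `0`. -/
theorem ceDiff_ιMulti (k : ℕ) (v : Fin (k + 2) → L) :
    ceDiff (ExteriorAlgebra.ιMulti ℝ (k + 2) v) =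
      ∑ i : Fin (k + 1), ∑ j ≥ i, (-1 : ℝ) ^ (i + j + 1 : ℕ) •
        (ExteriorAlgebra.ι ℝ ⁅v i.castSucc, v j.succ⁆ *
          ExteriorAlgebra.ιMulti ℝ k (j.removeNth (i.castSucc.removeNth v))) := by
  induction k with
  | zero =>
    have h1 (η : L) : ceDiff (ExteriorAlgebra.ι ℝ η) = 0 := by
      have := ceDiff_ι_mul η (algebraMap ℝ (ExteriorAlgebra ℝ L) 1)
      rwa [ceDiff_algebraMap, adExt_algebraMap, map_one, mul_one, mul_zero, neg_zero,
        sub_zero] at this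
    have h2 (ξ η : L) : adExt ξ (ExteriorAlgebra.ι ℝ η) = ExteriorAlgebra.ι ℝ ⁅ξ, η⁆ := by
      have := adExt_ι_mul ξ η (algebraMap ℝ (ExteriorAlgebra ℝ L) 1)
      rwa [adExt_algebraMap, map_one, mul_one, mul_one, mul_zero, add_zero] at this
    rw [ExteriorAlgebra.ιMulti_succ_apply, ExteriorAlgebra.ιMulti_succ_apply]
    simp [ceDiff_ι_mul, h1, h2, Matrix.vecTail]
  | succ k ih =>
    rw [ExteriorAlgebra.ιMulti_succ_apply, ceDiff_ι_mul, adExt_ιMulti', ih, Finset.mul_sum,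
      Fin.sum_univ_succ (fun i : Fin (k + 1 + 1) => ∑ j ≥ i, (-1 : ℝ) ^ (i + j + 1 : ℕ) •
        (ExteriorAlgebra.ι ℝ ⁅v i.castSucc, v j.succ⁆ *
          ExteriorAlgebra.ιMulti ℝ (k + 1) (j.removeNth (i.castSucc.removeNth v)))),
      sub_eq_add_neg, add_comm, ← Finset.sum_neg_distrib, ← Finset.sum_neg_distrib]
    congr 1
    · refine Finset.sum_congr (by ext; simp) fun j _ => ?_
      simp only [Fin.castSucc_zero, Fin.removeNth_zero, Fin.val_zero, zero_add, pow_succ, mul_neg,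
        mul_one, neg_smul]
      rfl
    · refine Finset.sum_congr rfl fun i _ => ?_
      have hI : Finset.Ici i.succ = (Finset.Ici i).map (Fin.succEmb (k + 1)) := by
        simp
      rw [hI, Finset.sum_map, Finset.mul_sum, ← Finset.sum_neg_distrib]
      refine Finset.sum_congr rfl fun j _ => ?_
      have h : ExteriorAlgebra.ιMulti ℝ (k + 1)
          (j.succ.removeNth (i.succ.castSucc.removeNth v)) = ExteriorAlgebra.ι ℝ (v 0) *
            ExteriorAlgebra.ιMulti ℝ k (j.removeNth (i.castSucc.removeNth (Matrix.vecTail v))) := by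
        rw [ιMulti_removeNth_succ]
        congr 3
        ext l
        simp [Fin.removeNth, Matrix.vecTail]
      simp only [Fin.coe_succEmb]
      rw [h, ι_mul_ι_mul_swap, Fin.val_succ, Fin.val_succ, mul_smul_comm, smul_neg]
      have hs : (-1 : ℝ) ^ ((i : ℕ) + 1 + (j + 1) + 1) = (-1) ^ ((i : ℕ) + j + 1) := by ring
      rw [hs]
      rfl

theorem adExt_mem (ξ : L) (k : ℕ) {x : ExteriorAlgebra ℝ L} (hx : x ∈ ⋀[ℝ]^k L) :
    adExt ξ x ∈ ⋀[ℝ]^k L := by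
  rw [← ExteriorAlgebra.ιMulti_span_fixedDegree] at hx ⊢
  induction hx using Submodule.span_induction with
  | mem x h =>
    obtain ⟨v, rfl⟩ := h
    rw [adExt_ιMulti]
    exact Submodule.sum_mem _ fun i _ => Submodule.subset_span ⟨_, rfl⟩
  | zero => rw [map_zero]; exact Submodule.zero_mem _
  | add x y _ _ hx hy => rw [map_add]; exact Submodule.add_mem _ hx hy
  | smul c x _ hx => rw [map_smul]; exact Submodule.smul_mem _ c hx

variable (L) in
/-- The `k`-th Lie kernel `P_{L,k}`: the kernel of the Chevalley–Eilenberg differential on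
`Λ^k L`. -/
def lieKernel (k : ℕ) : Submodule ℝ (⋀[ℝ]^k L) :=
  LinearMap.ker (ceDiff ∘ₗ (⋀[ℝ]^k L).subtype)

/-- The adjoint action of `L` on its `k`-th Lie kernel. -/
def adKernel (k : ℕ) : L →ₗ[ℝ] Module.End ℝ (lieKernel L k) where
  toFun ξ :=
    { toFun := fun p => ⟨⟨adExt ξ p, adExt_mem ξ k p.1.2⟩, by
        have hp : ceDiff (p : ExteriorAlgebra ℝ L) = 0 := p.2
        change ceDiff (adExt ξ (p : ExteriorAlgebra ℝ L)) = 0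
        rw [ceDiff_adExt, hp, map_zero]⟩
      map_add' := fun p q => Subtype.ext (Subtype.ext (map_add (adExt ξ) _ _))
      map_smul' := fun c p => Subtype.ext (Subtype.ext (map_smul (adExt ξ) c _)) }
  map_add' ξ η := LinearMap.ext fun p => Subtype.ext (Subtype.ext
    (LinearMap.congr_fun (map_add adExt ξ η) (p : ExteriorAlgebra ℝ L)))
  map_smul' c ξ := LinearMap.ext fun p => Subtype.ext (Subtype.ext
    (LinearMap.congr_fun (map_smul adExt c ξ) (p : ExteriorAlgebra ℝ L)))

/-- The coadjoint action on the dual of the Lie kernel, `(ξ · c)(p) = -c(ad_ξ p)`. -/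
def coadKernel (k : ℕ) : L →ₗ[ℝ] Module.End ℝ (Module.Dual ℝ (lieKernel L k)) where
  toFun ξ := -(adKernel k ξ).dualMap
  map_add' ξ η := by
    refine LinearMap.ext fun c => LinearMap.ext fun p => ?_
    change -c (adKernel k (ξ + η) p) = -c (adKernel k ξ p) + -c (adKernel k η p)
    rw [map_add, LinearMap.add_apply, map_add, neg_add]
  map_smul' r ξ := by
    refine LinearMap.ext fun c => LinearMap.ext fun p => ?_
    change -c (adKernel k (r • ξ) p) = r • -c (adKernel k ξ p)
    rw [map_smul, LinearMap.smul_apply, map_smul, smul_neg]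

/-- The action on a tensor product, `ξ · (r ⊗ s) = (ξ · r) ⊗ s + r ⊗ (ξ · s)`. -/
def tensorAction {R S : Type*} [AddCommGroup R] [Module ℝ R] [AddCommGroup S] [Module ℝ S]
    (ρ : L →ₗ[ℝ] Module.End ℝ R) (σ : L →ₗ[ℝ] Module.End ℝ S) :
    L →ₗ[ℝ] Module.End ℝ (TensorProduct ℝ R S) :=
  LinearMap.rTensorHom S ∘ₗ ρ + LinearMap.lTensorHom R ∘ₗ σ

/-- `H⁰(L, R)` for the action `ρ` of `L` on `R`: the kernel of `δ₀ : R → C¹(L, R)`,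
`(δ₀ r)(ξ) = ξ · r`. -/
def lieH0 {R : Type*} [AddCommGroup R] [Module ℝ R] (ρ : L →ₗ[ℝ] Module.End ℝ R) :
    Submodule ℝ R :=
  LinearMap.ker ρ.flip

theorem append_update_left {V : Type*} {k l : ℕ} (X : Fin k → V) (Y : Fin l → V) (i : Fin k)
    (a : V) : Fin.append (Function.update X i a) Y =
      Function.update (Fin.append X Y) (Fin.castAdd l i) a := by
  ext j
  refine Fin.addCases (fun j => ?_) (fun j => ?_) j
  · by_cases h : j = i
    · subst h; simp
    · simp [h]
  · have : Fin.natAdd k j ≠ Fin.castAdd l i := fun h => by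
      have := congrArg Fin.val h
      simp at this
      omega
    simp [this]

theorem append_update_right {V : Type*} {k l : ℕ} (X : Fin k → V) (Y : Fin l → V) (i : Fin l)
    (a : V) : Fin.append X (Function.update Y i a) =
      Function.update (Fin.append X Y) (Fin.natAdd k i) a := by
  ext j
  refine Fin.addCases (fun j => ?_) (fun j => ?_) j
  · have : Fin.castAdd l j ≠ Fin.natAdd k i := fun h => by
      have := congrArg Fin.val h
      simp at this
      omega
    simp [this]
  · by_cases h : j = i
    · subst h; simp
    · simp [h]

/-- The alternating form `(Y₁, …, Yₗ) ↦ τ(X₁, …, Xₖ, Y₁, …, Yₗ)`. -/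
def contractVec {V : Type*} [AddCommGroup V] [Module ℝ V] [TopologicalSpace V]
    {k l N : ℕ} (h : k + l = N) (τ : V [⋀^Fin N]→L[ℝ] ℝ) (X : Fin k → V) :
    V [⋀^Fin l]→L[ℝ] ℝ where
  toFun Y := τ (Fin.append X Y ∘ Fin.cast h.symm)
  map_update_add' := by
    subst h
    intro inst Y i a b
    simp only [Fin.cast_refl, Function.comp_id]
    obtain rfl : inst = instDecidableEqFin l := Subsingleton.elim _ _
    simp only [append_update_right, ContinuousAlternatingMap.map_update_add]
  map_update_smul' := by
    subst h
    intro inst Y i c a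
    simp only [Fin.cast_refl, Function.comp_id]
    obtain rfl : inst = instDecidableEqFin l := Subsingleton.elim _ _
    simp only [append_update_right, ContinuousAlternatingMap.map_update_smul]
  map_eq_zero_of_eq' := by
    subst h
    intro Y i j hij hne
    simp only [Fin.cast_refl, Function.comp_id]
    exact τ.map_eq_zero_of_eq _ (i := Fin.natAdd k i) (j := Fin.natAdd k j) (by simpa using hij)
      (by simpa using hne)
  cont := by
    subst h
    refine τ.coe_continuous.comp (continuous_pi fun j => ?_)
    refine Fin.addCases (fun j => ?_) (fun j => ?_) j
    · simpa using continuous_const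
    · simpa using continuous_apply j

/-- The contraction `X ⌟ τ` of an alternating form `τ` of degree `N = k + l` with a `k`-vector `X`,
`((X₁ ∧ ⋯ ∧ Xₖ) ⌟ τ)(Y₁, …, Yₗ) = τ(X₁, …, Xₖ, Y₁, …, Yₗ)`, extended linearly in `X`. -/
def contract {V : Type*} [AddCommGroup V] [Module ℝ V] [TopologicalSpace V]
    {k l N : ℕ} (h : k + l = N) (τ : V [⋀^Fin N]→L[ℝ] ℝ) :
    ⋀[ℝ]^k V →ₗ[ℝ] V [⋀^Fin l]→L[ℝ] ℝ :=
  exteriorPower.alternatingMapLinearEquiv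
    { toFun := contractVec h τ
      map_update_add' := by
        subst h
        intro inst X i a b
        obtain rfl : inst = instDecidableEqFin k := Subsingleton.elim _ _
        ext Y
        change τ (Fin.append _ Y) = τ (Fin.append _ Y) + τ (Fin.append _ Y)
        simp only [append_update_left, ContinuousAlternatingMap.map_update_add]
      map_update_smul' := by
        subst h
        intro inst X i c a
        obtain rfl : inst = instDecidableEqFin k := Subsingleton.elim _ _
        ext Y
        change τ (Fin.append _ Y) = c • τ (Fin.append _ Y)
        simp only [append_update_left, ContinuousAlternatingMap.map_update_smul]
      map_eq_zero_of_eq' := by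
        subst h
        intro X i j hij hne
        ext Y
        exact τ.map_eq_zero_of_eq (Fin.append X Y) (i := Fin.castAdd l i) (j := Fin.castAdd l j)
          (by simpa using hij) (by simpa using hne) }

end Algebra
section Forms
variable {E : Type*} [NormedAddCommGroup E] [NormedSpace ℝ E]
  {M : Type*} [TopologicalSpace M] [ChartedSpace E M]

/-- The expression of a family of alternating forms on the tangent spaces in the chart at `x₀`:
its pullback under the inverse of the chart. -/
def chartRep {k : ℕ} (x₀ : M) (α : ∀ x : M, TangentSpace 𝓘(ℝ, E) x [⋀^Fin k]→L[ℝ] ℝ) (y : E) :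
    E [⋀^Fin k]→L[ℝ] ℝ :=
  (α ((extChartAt 𝓘(ℝ, E) x₀).symm y)).compContinuousLinearMap
    (mfderiv 𝓘(ℝ, E) 𝓘(ℝ, E) (extChartAt 𝓘(ℝ, E) x₀).symm y)

theorem chartRep_add {k : ℕ} (x₀ : M)
    (α β : ∀ x : M, TangentSpace 𝓘(ℝ, E) x [⋀^Fin k]→L[ℝ] ℝ) :
    chartRep x₀ (α + β) = chartRep x₀ α + chartRep x₀ β := rfl

theorem chartRep_smul {k : ℕ} (x₀ : M) (c : ℝ)
    (α : ∀ x : M, TangentSpace 𝓘(ℝ, E) x [⋀^Fin k]→L[ℝ] ℝ) :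
    chartRep x₀ (c • α) = c • chartRep x₀ α := rfl

variable (E M) in
/-- The space `Ω^k(M)` of smooth differential `k`-forms on `M`. -/
def DiffForm (k : ℕ) : Submodule ℝ (∀ x : M, TangentSpace 𝓘(ℝ, E) x [⋀^Fin k]→L[ℝ] ℝ) where
  carrier := {α | ∀ x₀ : M, ContDiffOn ℝ ∞ (chartRep x₀ α) (extChartAt 𝓘(ℝ, E) x₀).target}
  add_mem' ha hb x₀ := by
    rw [chartRep_add]
    exact (ha x₀).add (hb x₀)
  zero_mem' x₀ := contDiffOn_const (c := 0)
  smul_mem' c α ha x₀ := by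
    rw [chartRep_smul]
    exact contDiffOn_const.smul (ha x₀)

instance DiffForm.instAddCommGroup (k : ℕ) : AddCommGroup (DiffForm E M k) :=
  (DiffForm E M k).addCommGroup

/-- The exterior derivative at `x`, computed in the chart at `x`. -/
def extDerivAt {k : ℕ} (α : ∀ x : M, TangentSpace 𝓘(ℝ, E) x [⋀^Fin k]→L[ℝ] ℝ) (x : M) :
    TangentSpace 𝓘(ℝ, E) x [⋀^Fin (k + 1)]→L[ℝ] ℝ :=
  (extDeriv (chartRep x α) (extChartAt 𝓘(ℝ, E) x x)).compContinuousLinearMap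
    (mfderiv 𝓘(ℝ, E) 𝓘(ℝ, E) (extChartAt 𝓘(ℝ, E) x) x)

theorem target_mem_nhds (x₀ : M) {y : E} (hy : y ∈ (extChartAt 𝓘(ℝ, E) x₀).target) :
    (extChartAt 𝓘(ℝ, E) x₀).target ∈ nhds y :=
  (isOpen_extChartAt_target x₀).mem_nhds hy

theorem differentiableAt_chartRep {k : ℕ} (α : DiffForm E M k) (x₀ : M) {y : E}
    (hy : y ∈ (extChartAt 𝓘(ℝ, E) x₀).target) : DifferentiableAt ℝ (chartRep x₀ α.1) y :=
  ((α.2 x₀).contDiffAt (target_mem_nhds x₀ hy)).differentiableAt (by simp)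

variable [IsManifold 𝓘(ℝ, E) ∞ M]

theorem mdifferentiableAt_symm (x₀ : M) {y : E} (hy : y ∈ (extChartAt 𝓘(ℝ, E) x₀).target) :
    MDifferentiableAt 𝓘(ℝ, E) 𝓘(ℝ, E) (extChartAt 𝓘(ℝ, E) x₀).symm y := by
  have := mdifferentiableWithinAt_extChartAt_symm (I := 𝓘(ℝ, E)) hy
  rwa [ModelWithCorners.range_eq_univ, mdifferentiableWithinAt_univ] at this

/-- The transition map from the chart at `x₀` to the chart at `x`. -/
def transition (x₀ x : M) : E → E := extChartAt 𝓘(ℝ, E) x ∘ (extChartAt 𝓘(ℝ, E) x₀).symm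

theorem chartRep_eq_pullback {k : ℕ} (x₀ x : M)
    (α : ∀ x : M, TangentSpace 𝓘(ℝ, E) x [⋀^Fin k]→L[ℝ] ℝ) {y : E}
    (hy : y ∈ (extChartAt 𝓘(ℝ, E) x₀).target)
    (hx : (extChartAt 𝓘(ℝ, E) x₀).symm y ∈ (extChartAt 𝓘(ℝ, E) x).source) :
    chartRep x₀ α y =
      (chartRep x α (transition x₀ x y)).compContinuousLinearMap
        (fderiv ℝ (transition x₀ x) y) := by
  have hsrc : ∀ᶠ z in nhds y, (extChartAt 𝓘(ℝ, E) x₀).symm z ∈ (extChartAt 𝓘(ℝ, E) x).source :=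
    (mdifferentiableAt_symm x₀ hy).continuousAt.eventually
      ((isOpen_extChartAt_source x).mem_nhds hx)
  have hev : (extChartAt 𝓘(ℝ, E) x₀).symm =ᶠ[nhds y]
      (extChartAt 𝓘(ℝ, E) x).symm ∘ transition x₀ x := by
    filter_upwards [hsrc] with z hz
    exact ((extChartAt 𝓘(ℝ, E) x).left_inv hz).symm
  have hd1 : MDifferentiableAt 𝓘(ℝ, E) 𝓘(ℝ, E) (transition x₀ x) y :=
    (mdifferentiableAt_extChartAt (by simpa using hx)).comp y (mdifferentiableAt_symm x₀ hy)
  have hd2 : MDifferentiableAt 𝓘(ℝ, E) 𝓘(ℝ, E) (extChartAt 𝓘(ℝ, E) x).symm (transition x₀ x y) :=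
    mdifferentiableAt_symm x ((extChartAt 𝓘(ℝ, E) x).map_source hx)
  have hder : mfderiv 𝓘(ℝ, E) 𝓘(ℝ, E) (extChartAt 𝓘(ℝ, E) x₀).symm y =
      (mfderiv 𝓘(ℝ, E) 𝓘(ℝ, E) (extChartAt 𝓘(ℝ, E) x).symm (transition x₀ x y)) ∘L
        (mfderiv 𝓘(ℝ, E) 𝓘(ℝ, E) (transition x₀ x) y) := by
    rw [hev.mfderiv_eq]
    exact mfderiv_comp y hd2 hd1
  have hpt : (extChartAt 𝓘(ℝ, E) x).symm (transition x₀ x y) = (extChartAt 𝓘(ℝ, E) x₀).symm y :=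
    (extChartAt 𝓘(ℝ, E) x).left_inv hx
  have aux : ∀ (p q : M) (_ : p = q) (w : Fin k → E), α p w = α q w := by
    rintro p _ rfl w
    rfl
  ext v
  rw [← mfderiv_eq_fderiv]
  refine Eq.trans ?_ (aux _ _ hpt _).symm
  refine congrArg (α _) (funext fun i => ?_)
  exact DFunLike.congr_fun hder (v i)

theorem contDiffAt_transition (x₀ x : M) {y : E}
    (hy : y ∈ (extChartAt 𝓘(ℝ, E) x₀).target)
    (hx : (extChartAt 𝓘(ℝ, E) x₀).symm y ∈ (extChartAt 𝓘(ℝ, E) x).source) :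
    ContDiffAt ℝ ∞ (transition x₀ x) y := by
  rw [← contMDiffAt_iff_contDiffAt]
  have h1 : ContMDiffAt 𝓘(ℝ, E) 𝓘(ℝ, E) ∞ (extChartAt 𝓘(ℝ, E) x)
      ((extChartAt 𝓘(ℝ, E) x₀).symm y) :=
    contMDiffAt_extChartAt' (by rwa [extChartAt_source] at hx)
  have h2 : ContMDiffAt 𝓘(ℝ, E) 𝓘(ℝ, E) ∞ (extChartAt 𝓘(ℝ, E) x₀).symm y :=
    (contMDiffOn_extChartAt_symm x₀).contMDiffAt (target_mem_nhds x₀ hy)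
  exact h1.comp y h2

/-- The exterior derivative is computed by the usual formula in every chart. -/
theorem chartRep_extDerivAt {k : ℕ} (α : DiffForm E M k) (x₀ : M) {y : E}
    (hy : y ∈ (extChartAt 𝓘(ℝ, E) x₀).target) :
    chartRep x₀ (extDerivAt α.1) y = extDeriv (chartRep x₀ α.1) y := by
  set x := (extChartAt 𝓘(ℝ, E) x₀).symm y with hxdef
  have hx : x ∈ (extChartAt 𝓘(ℝ, E) x).source := mem_extChartAt_source x
  have hsrc : ∀ᶠ z in nhds y, (extChartAt 𝓘(ℝ, E) x₀).symm z ∈ (extChartAt 𝓘(ℝ, E) x).source :=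
    (mdifferentiableAt_symm x₀ hy).continuousAt.eventually
      ((isOpen_extChartAt_source x).mem_nhds hx)
  have hev : chartRep x₀ α.1 =ᶠ[nhds y] fun z =>
      (chartRep x α.1 (transition x₀ x z)).compContinuousLinearMap
        (fderiv ℝ (transition x₀ x) z) := by
    filter_upwards [hsrc, target_mem_nhds x₀ hy] with z hz hz'
    exact chartRep_eq_pullback x₀ x α.1 hz' hz
  have hT := contDiffAt_transition x₀ x hy hx
  have hα : DifferentiableAt ℝ (chartRep x α.1) (transition x₀ x y) := by
    have ht := (extChartAt 𝓘(ℝ, E) x).map_source hx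
    exact ((α.2 x).contDiffAt (target_mem_nhds x ht)).differentiableAt (by simp)
  rw [hev.extDeriv_eq, extDeriv_pullback hα hT
    (minSmoothness_of_isRCLikeNormedField.trans_le ENat.LEInfty.out)]
  have hd1 : fderiv ℝ (transition x₀ x) y = (mfderiv 𝓘(ℝ, E) 𝓘(ℝ, E) (extChartAt 𝓘(ℝ, E) x) x) ∘L
      (mfderiv 𝓘(ℝ, E) 𝓘(ℝ, E) (extChartAt 𝓘(ℝ, E) x₀).symm y) := by
    rw [← mfderiv_eq_fderiv]
    exact mfderiv_comp y (mdifferentiableAt_extChartAt (by rwa [extChartAt_source] at hx))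
      (mdifferentiableAt_symm x₀ hy)
  rw [hd1]
  rfl

theorem chartRep_extDerivAt_eqOn {k : ℕ} (α : DiffForm E M k) (x₀ : M) :
    Set.EqOn (chartRep x₀ (extDerivAt α.1)) (extDeriv (chartRep x₀ α.1))
      (extChartAt 𝓘(ℝ, E) x₀).target :=
  fun _ hy => chartRep_extDerivAt α x₀ hy

/-- The exterior derivative `d : Ω^k(M) → Ω^{k+1}(M)`. -/
def extDer (k : ℕ) : DiffForm E M k →ₗ[ℝ] DiffForm E M (k + 1) where
  toFun α := ⟨extDerivAt α.1, fun x₀ => by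
    refine ContDiffOn.congr ?_ (chartRep_extDerivAt_eqOn α x₀)
    exact (ContinuousAlternatingMap.alternatizeUncurryFinCLM ℝ E ℝ).contDiff.comp_contDiffOn
      ((α.2 x₀).fderiv_of_isOpen (isOpen_extChartAt_target x₀) (m := ∞) (by simp))⟩
  map_add' α β := by
    refine Subtype.ext (funext fun x => ?_)
    have hx := mem_extChartAt_target (I := 𝓘(ℝ, E)) x
    change extDerivAt (α.1 + β.1) x = extDerivAt α.1 x + extDerivAt β.1 x
    unfold extDerivAt
    rw [chartRep_add, extDeriv_add (differentiableAt_chartRep α x hx)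
      (differentiableAt_chartRep β x hx)]
    rfl
  map_smul' c α := by
    refine Subtype.ext (funext fun x => ?_)
    change extDerivAt (c • α.1) x = c • extDerivAt α.1 x
    unfold extDerivAt
    rw [chartRep_smul, extDeriv_smul]
    rfl

theorem extDer_extDer {k : ℕ} (α : DiffForm E M k) : extDer (k + 1) (extDer k α) = 0 := by
  refine Subtype.ext (funext fun x => ?_)
  change extDerivAt (extDerivAt α.1) x = 0
  have hx := mem_extChartAt_target (I := 𝓘(ℝ, E)) x
  have hev : chartRep x (extDerivAt α.1) =ᶠ[nhds (extChartAt 𝓘(ℝ, E) x x)]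
      extDeriv (chartRep x α.1) :=
    (chartRep_extDerivAt_eqOn α x).eventuallyEq_of_mem (target_mem_nhds x hx)
  change (extDeriv (chartRep x (extDerivAt α.1)) _).compContinuousLinearMap _ = 0
  rw [hev.extDeriv_eq, extDeriv_extDeriv_apply ((α.2 x).contDiffAt (target_mem_nhds x hx))
    (minSmoothness_of_isRCLikeNormedField.trans_le ENat.LEInfty.out)]
  rfl

variable (E M) in
/-- The space `Ω^k_cl(M)` of closed `k`-forms. -/
def ClosedForm (k : ℕ) : Submodule ℝ (DiffForm E M k) := LinearMap.ker (extDer k)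

instance ClosedForm.instAddCommGroup (k : ℕ) : AddCommGroup (ClosedForm E M k) :=
  (ClosedForm E M k).addCommGroup

variable (E M) in
/-- The space `Γ(TM)` of smooth vector fields. -/
abbrev VField := Cₛ^∞⟮𝓘(ℝ, E); E, (TangentSpace 𝓘(ℝ, E) : M → Type _)⟯

/-- The contraction of a form with a vector field at `x`. -/
def interiorAt {k : ℕ} (X : ∀ x : M, TangentSpace 𝓘(ℝ, E) x)
    (α : ∀ x : M, TangentSpace 𝓘(ℝ, E) x [⋀^Fin (k + 1)]→L[ℝ] ℝ) (x : M) :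
    TangentSpace 𝓘(ℝ, E) x [⋀^Fin k]→L[ℝ] ℝ :=
  ContinuousAlternatingMap.curryLeft (E := E) (α x) (X x)

theorem contDiffOn_vectorField (X : VField E M) (x₀ : M) :
    ContDiffOn ℝ ∞ (fun y => (mfderiv 𝓘(ℝ, E) 𝓘(ℝ, E) (extChartAt 𝓘(ℝ, E) x₀)
      ((extChartAt 𝓘(ℝ, E) x₀).symm y) (X ((extChartAt 𝓘(ℝ, E) x₀).symm y)) : E))
      (extChartAt 𝓘(ℝ, E) x₀).target := by
  have h := ((trivializationAt E (TangentSpace 𝓘(ℝ, E) : M → Type _)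
    x₀).contMDiffOn_section_baseSet_iff (IB := 𝓘(ℝ, E)) (n := ∞)).1 X.contMDiff.contMDiffOn
  have h2 := h.comp (contMDiffOn_extChartAt_symm (I := 𝓘(ℝ, E)) (n := ∞) x₀) (fun y hy => by
    simpa using (extChartAt 𝓘(ℝ, E) x₀).map_target hy)
  rw [contMDiffOn_iff_contDiffOn] at h2
  refine h2.congr fun y hy => ?_
  have hs : (extChartAt 𝓘(ℝ, E) x₀).symm y ∈ (chartAt E x₀).source := by
    simpa using (extChartAt 𝓘(ℝ, E) x₀).map_target hy
  refine (DFunLike.congr_fun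
    (TangentBundle.continuousLinearMapAt_trivializationAt (I := 𝓘(ℝ, E)) hs).symm _).trans ?_
  exact congrFun (Bundle.Trivialization.coe_linearMapAt_of_mem _ hs) _

theorem chartRep_interiorAt {k : ℕ} (X : ∀ x : M, TangentSpace 𝓘(ℝ, E) x)
    (α : ∀ x : M, TangentSpace 𝓘(ℝ, E) x [⋀^Fin (k + 1)]→L[ℝ] ℝ) (x₀ : M) {y : E}
    (hy : y ∈ (extChartAt 𝓘(ℝ, E) x₀).target) :
    chartRep x₀ (interiorAt X α) y = (chartRep x₀ α y).curryLeft
      (mfderiv 𝓘(ℝ, E) 𝓘(ℝ, E) (extChartAt 𝓘(ℝ, E) x₀)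
        ((extChartAt 𝓘(ℝ, E) x₀).symm y) (X ((extChartAt 𝓘(ℝ, E) x₀).symm y)) : E) := by
  have h := mfderivWithin_extChartAt_symm_comp_mfderiv_extChartAt (I := 𝓘(ℝ, E)) hy
  rw [ModelWithCorners.range_eq_univ, mfderivWithin_univ] at h
  have h2 := DFunLike.congr_fun h (X ((extChartAt 𝓘(ℝ, E) x₀).symm y))
  ext v
  change α _ (Matrix.vecCons _ _) = α _ _
  congr 1
  ext i
  refine Fin.cases ?_ (fun j => ?_) i
  · exact h2.symm
  · rfl

/-- The interior product `X ⌟ α`, bilinear in the vector field and the form. -/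
def interior (k : ℕ) : VField E M →ₗ[ℝ] DiffForm E M (k + 1) →ₗ[ℝ] DiffForm E M k :=
  LinearMap.mk₂ ℝ
    (fun X α => ⟨interiorAt X α.1, fun x₀ => by
      refine ContDiffOn.congr ?_ (fun y hy => chartRep_interiorAt X α.1 x₀ hy)
      exact ((ContinuousAlternatingMap.curryLeftLI
        (𝕜 := ℝ) (E := E) (F := ℝ) (n := k)).toContinuousLinearMap.contDiff.comp_contDiffOn
          (α.2 x₀)).clm_apply (contDiffOn_vectorField X x₀)⟩)
    (fun X Y α => Subtype.ext (funext fun x =>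
      map_add (ContinuousAlternatingMap.curryLeft (E := E) (α.1 x)) (X x) (Y x)))
    (fun c X α => Subtype.ext (funext fun x =>
      map_smul (ContinuousAlternatingMap.curryLeft (E := E) (α.1 x)) c (X x)))
    (fun _ _ _ => rfl)
    (fun _ _ _ => rfl)

/-- The Lie derivative `L_X α = d(X ⌟ α) + X ⌟ dα`, where `X ⌟ α = 0` if `α` has degree `0`. -/
def lieDer : (k : ℕ) → VField E M →ₗ[ℝ] DiffForm E M k →ₗ[ℝ] DiffForm E M k
  | 0 => (interior 0).compl₂ (extDer 0)
  | k + 1 => (interior k).compr₂ (extDer k) + (interior (k + 1)).compl₂ (extDer (k + 1))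

theorem lieDer_mem_closedForm (k : ℕ) (X : VField E M) (α : DiffForm E M k)
    (hα : α ∈ ClosedForm E M k) : lieDer k X α ∈ ClosedForm E M k := by
  have h : extDer k α = 0 := hα
  change extDer k (lieDer k X α) = 0
  cases k with
  | zero =>
    have : lieDer 0 X α = interior 0 X (extDer 0 α) := rfl
    rw [this, h, map_zero, map_zero]
  | succ k =>
    have : lieDer (k + 1) X α =
      extDer k (interior k X α) + interior (k + 1) X (extDer (k + 1) α) := rfl
    rw [this, h, map_zero, add_zero, extDer_extDer]

end Forms

section Action
variable {E : Type*} [NormedAddCommGroup E] [NormedSpace ℝ E]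
  {M : Type*} [TopologicalSpace M] [ChartedSpace E M] [IsManifold 𝓘(ℝ, E) ∞ M]
  {F : Type*} [NormedAddCommGroup F] [NormedSpace ℝ F]
  {G : Type*} [TopologicalSpace G] [ChartedSpace F G] [Group G] [LieGroup 𝓘(ℝ, F) ∞ G]
  [MulAction G M] [ContMDiffSMul 𝓘(ℝ, F) 𝓘(ℝ, E) ∞ G M]

instance instLieGroupMinSmoothness : LieGroup 𝓘(ℝ, F) (minSmoothness ℝ 3) G :=
  LieGroup.of_le (n := ∞) (minSmoothness_of_isRCLikeNormedField.trans_le ENat.LEInfty.out)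

variable (E F G) in
/-- The infinitesimal generator `V_ξ(x)` of the action at `x`, as a linear function of `ξ`: the
derivative at `1` of the orbit map `g ↦ g • x`. -/
def infGenAt (x : M) : GroupLieAlgebra 𝓘(ℝ, F) G →ₗ[ℝ] TangentSpace 𝓘(ℝ, E) x :=
  (mfderiv 𝓘(ℝ, F) 𝓘(ℝ, E) (fun g : G => g • x) 1 :
    GroupLieAlgebra 𝓘(ℝ, F) G →ₗ[ℝ] TangentSpace 𝓘(ℝ, E) ((1 : G) • x))

theorem contMDiff_infGenAt (ξ : GroupLieAlgebra 𝓘(ℝ, F) G) :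
    ContMDiff 𝓘(ℝ, E) 𝓘(ℝ, E).tangent ∞
      (fun x : M => (⟨x, infGenAt E F G x ξ⟩ : TangentBundle 𝓘(ℝ, E) M)) := by
  let f₁ : M → TangentBundle 𝓘(ℝ, F) G × TangentBundle 𝓘(ℝ, E) M :=
    fun x => (⟨1, ξ⟩, ⟨x, 0⟩)
  have s₁ : ContMDiff 𝓘(ℝ, E) (𝓘(ℝ, F).tangent.prod 𝓘(ℝ, E).tangent) ∞ f₁ :=
    contMDiff_const.prodMk (Bundle.contMDiff_zeroSection ℝ (TangentSpace 𝓘(ℝ, E) : M → Type _))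
  let f₂ := (equivTangentBundleProd 𝓘(ℝ, F) G 𝓘(ℝ, E) M).symm
  have s₂ : ContMDiff (𝓘(ℝ, F).tangent.prod 𝓘(ℝ, E).tangent) (𝓘(ℝ, F).prod 𝓘(ℝ, E)).tangent ∞ f₂ :=
    contMDiff_equivTangentBundleProd_symm
  have sm : ContMDiff (𝓘(ℝ, F).prod 𝓘(ℝ, E)) 𝓘(ℝ, E) ∞ (fun p : G × M => p.1 • p.2) :=
    ContMDiffSMul.contMDiff_smul
  let f₃ := tangentMap (𝓘(ℝ, F).prod 𝓘(ℝ, E)) 𝓘(ℝ, E) (fun p : G × M => p.1 • p.2)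
  have s₃ : ContMDiff (𝓘(ℝ, F).prod 𝓘(ℝ, E)).tangent 𝓘(ℝ, E).tangent ∞ f₃ :=
    sm.contMDiff_tangentMap (m := ∞) (by simp)
  refine ((s₃.comp s₂).comp s₁).congr fun x => ?_
  have hd := mfderiv_prod_eq_add_apply (I := 𝓘(ℝ, F)) (I' := 𝓘(ℝ, E)) (I'' := 𝓘(ℝ, E))
    (p := ((1 : G), x)) (v := ((ξ : TangentSpace 𝓘(ℝ, F) (1 : G)), (0 : TangentSpace 𝓘(ℝ, E) x)))
    (sm.mdifferentiableAt (by simp))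
  have aux : ∀ (a b : M) (_ : a = b) (u : E),
      (⟨a, u⟩ : TangentBundle 𝓘(ℝ, E) M) = ⟨b, u⟩ := by
    rintro a _ rfl u
    rfl
  refine (aux _ _ (one_smul G x).symm _).trans ?_
  refine congrArg (Bundle.TotalSpace.mk ((1 : G) • x)) ?_
  refine Eq.trans ?_ hd.symm
  exact (add_zero _).symm.trans (congrArg _ (map_zero _).symm)

variable (E M F G) in
/-- The vector field `V_ξ` of the action. -/
def infGen : GroupLieAlgebra 𝓘(ℝ, F) G →ₗ[ℝ] VField E M where
  toFun ξ := ⟨fun x => infGenAt E F G x ξ, contMDiff_infGenAt ξ⟩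
  map_add' ξ η := ContMDiffSection.ext fun x => map_add (infGenAt E F G x) ξ η
  map_smul' c ξ := ContMDiffSection.ext fun x => map_smul (infGenAt E F G x) c ξ

variable (E M F G) in
/-- The action of the Lie algebra on closed `k`-forms, `ξ · α = -L_{V_ξ} α`. It is the derivative
of the action `g · α = Φ_{g⁻¹}^* α` of the group. -/
def closedFormAction (k : ℕ) :
    GroupLieAlgebra 𝓘(ℝ, F) G →ₗ[ℝ] Module.End ℝ (ClosedForm E M k) where
  toFun ξ :=
    { toFun := fun α => ⟨-lieDer k (infGen E M F G ξ) α.1,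
        neg_mem (lieDer_mem_closedForm k (infGen E M F G ξ) α.1 α.2)⟩
      map_add' := fun α β => Subtype.ext (by
        change -lieDer k (infGen E M F G ξ) (α.1 + β.1) =
          -lieDer k (infGen E M F G ξ) α.1 + -lieDer k (infGen E M F G ξ) β.1
        rw [map_add, neg_add])
      map_smul' := fun c α => Subtype.ext (by
        change -lieDer k (infGen E M F G ξ) (c • α.1) = c • -lieDer k (infGen E M F G ξ) α.1
        rw [map_smul, smul_neg]) }
  map_add' ξ η := by
    refine LinearMap.ext fun α => Subtype.ext ?_
    change -lieDer k (infGen E M F G (ξ + η)) α.1 =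
      -lieDer k (infGen E M F G ξ) α.1 + -lieDer k (infGen E M F G η) α.1
    rw [map_add, map_add, LinearMap.add_apply, neg_add]
  map_smul' c ξ := by
    refine LinearMap.ext fun α => Subtype.ext ?_
    change -lieDer k (infGen E M F G (c • ξ)) α.1 = c • -lieDer k (infGen E M F G ξ) α.1
    rw [map_smul, map_smul, LinearMap.smul_apply, smul_neg]

/-- The multivector `V_p(x) = V_{ξ₁}(x) ∧ ⋯ ∧ V_{ξₖ}(x)` for `p = ξ₁ ∧ ⋯ ∧ ξₖ`, extended linearly
to all `p ∈ Λ^k 𝔤`. -/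
def genMultivector {k : ℕ} (p : ⋀[ℝ]^k (GroupLieAlgebra 𝓘(ℝ, F) G)) (x : M) :
    ⋀[ℝ]^k (TangentSpace 𝓘(ℝ, E) x) :=
  exteriorPower.map k (infGenAt E F G x) p

/-- The derivative at `x` of the chart at `x₀`. -/
def chartDeriv (x₀ x : M) : TangentSpace 𝓘(ℝ, E) x →ₗ[ℝ] E :=
  (mfderiv 𝓘(ℝ, E) 𝓘(ℝ, E) (extChartAt 𝓘(ℝ, E) x₀) x).toLinearMap

/-- Smoothness of a family of `k`-vectors on the tangent spaces: in every chart, its components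
are smooth functions. -/
def IsSmoothMultivectorField {k : ℕ} (X : ∀ x : M, ⋀[ℝ]^k (TangentSpace 𝓘(ℝ, E) x)) : Prop :=
  ∀ (x₀ : M) (ℓ : ⋀[ℝ]^k E →ₗ[ℝ] ℝ), ContDiffOn ℝ ∞
    (fun y => ℓ (exteriorPower.map k
      (chartDeriv x₀ ((extChartAt 𝓘(ℝ, E) x₀).symm y))
      (X ((extChartAt 𝓘(ℝ, E) x₀).symm y))))
    (extChartAt 𝓘(ℝ, E) x₀).target

/-- An `n`-plectic form: a closed `(n+1)`-form `Ω` such that `v ↦ v ⌟ Ω` is injective on every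
tangent space. -/
structure IsPlectic {n : ℕ} (Ω : DiffForm E M (n + 1)) : Prop where
  closed : extDer (n + 1) Ω = 0
  nondegenerate : ∀ x : M, Function.Injective (fun v : TangentSpace 𝓘(ℝ, E) x =>
    ContinuousAlternatingMap.curryLeft (E := E) (Ω.1 x) v)

variable (G) in
/-- The action of `G` preserves the form `Ω`: `Φ_g^* Ω = Ω` for every `g`. -/
def PreservesForm {k : ℕ} (Ω : DiffForm E M k) : Prop :=
  ∀ (g : G) (x : M), (Ω.1 (g • x)).compContinuousLinearMap
    (mfderiv 𝓘(ℝ, E) 𝓘(ℝ, E) (fun y : M => g • y) x) = Ω.1 x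

/-- Hamiltonian `(n-k)`-forms: there is a smooth `k`-vector field `X` with `dα = -X ⌟ Ω`. -/
def IsHamiltonianForm {n : ℕ} (Ω : DiffForm E M (n + 1)) (k : ℕ) (hk : k ≤ n)
    (α : DiffForm E M (n - k)) : Prop :=
  ∃ X : ∀ x : M, ⋀[ℝ]^k (TangentSpace 𝓘(ℝ, E) x), IsSmoothMultivectorField X ∧
    ∀ x : M, (extDer (n - k) α).1 x =
      -contract (show k + (n - k + 1) = n + 1 by omega) (Ω.1 x) (X x)

/-- The sign `ζ(k) = -(-1)^{k(k+1)/2}`. -/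
def zetaSign (k : ℕ) : ℝ := -(-1) ^ (k * (k + 1) / 2)

variable [FiniteDimensional ℝ F]

/-- A weak `k`-moment map: a linear map `f : P_{𝔤,k} → Ω^{n-k}_Ham(M)` with
`d f(p) = -ζ(k) V_p ⌟ Ω`. -/
structure IsWeakMomentComponent {n : ℕ} (Ω : DiffForm E M (n + 1)) (k : ℕ) (hk : k ≤ n)
    (f : lieKernel (GroupLieAlgebra 𝓘(ℝ, F) G) k →ₗ[ℝ] DiffForm E M (n - k)) : Prop where
  hamiltonian : ∀ p, IsHamiltonianForm Ω k hk (f p)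
  extDer_eq : ∀ (p : lieKernel (GroupLieAlgebra 𝓘(ℝ, F) G) k) (x : M),
    (extDer (n - k) (f p)).1 x =
      -(zetaSign k • contract (show k + (n - k + 1) = n + 1 by omega) (Ω.1 x)
        (genMultivector p.1 x))

/-- A (full) weak moment map: a family of weak `k`-moment maps for `1 ≤ k ≤ n`. -/
def IsWeakMomentMap {n : ℕ} (Ω : DiffForm E M (n + 1))
    (f : ∀ k : ℕ, 1 ≤ k → k ≤ n →
      (lieKernel (GroupLieAlgebra 𝓘(ℝ, F) G) k →ₗ[ℝ] DiffForm E M (n - k))) : Prop :=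
  ∀ (k : ℕ) (hk₁ : 1 ≤ k) (hk : k ≤ n), IsWeakMomentComponent Ω k hk (f k hk₁ hk)

end Action

end Multisymplectic

end

open Multisymplectic
open scoped Manifold ContDiff

/-!
Write `L_ξ = d ι_ξ + ι_ξ d` with `ι_ξ` the interior product with `V_ξ`, and extend `ι` to `Λ𝔤` by
`ι_{ξ ∧ x} = ι_ξ ι_x`. For a left action `[L_ξ, ι_η] = -ι_[ξ, η]`, hence `[L_ξ, ι_x] = -ι_{ad_ξ x}`,
and on a closed invariant form `Ω` an induction on the degree of `x` gives `d ι_x Ω = ι_{∂x} Ω`. So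
for `p` in the Lie kernel `ι_p Ω` is closed, and then `ι_{ad_ξ p} Ω = -L_ξ ι_p Ω = -d ι_ξ ι_p Ω` is
exact. The `p` for which `ι_p Ω` is exact thus form a subspace containing every `ad_ξ p`. A linear
functional on the Lie kernel that vanishes on this subspace is invariant, so if `H⁰(𝔤, P*) = 0`, all
`ι_p Ω` are exact, and a linear choice of primitives is, up to sign, a weak moment map. Part 2
reduces to part 1, since a nonzero invariant of `P*` tensored with a nonzero invariant closed form
would be a nonzero invariant of the tensor product.
-/

noncomputable section

namespace Multisymplectic

section LocalCalculus

variable {𝕜 : Type*} [NontriviallyNormedField 𝕜]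
  {E : Type*} [NormedAddCommGroup E] [NormedSpace 𝕜 E]
  {W : Type*} [NormedAddCommGroup W] [NormedSpace 𝕜 W] {k : ℕ}

theorem update_vecCons_zero {α : Type*} (a b : α) (v : Fin k → α) :
    Function.update (Matrix.vecCons a v) 0 b = Matrix.vecCons b v :=
  Fin.update_cons_zero (α := fun _ => α) a v b

theorem update_vecCons_succ {α : Type*} (a b : α) (v : Fin k → α) (i : Fin k) :
    Function.update (Matrix.vecCons a v) i.succ b = Matrix.vecCons a (Function.update v i b) :=
  (Fin.cons_update (α := fun _ => α) a v i b).symm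

theorem map_update_eq_vecCons_removeNth (τ : E [⋀^Fin (k + 1)]→L[𝕜] W) (v : Fin (k + 1) → E)
    (i : Fin (k + 1)) (a : E) :
    τ (Function.update v i a) =
      (-1 : ℤ) ^ (i : ℕ) • τ (Matrix.vecCons a (i.removeNth v)) := by
  rw [← Fin.insertNth_removeNth]
  simpa using τ.toAlternatingMap.map_insertNth i a (i.removeNth v)

theorem fderiv_curryLeft_apply {τ : E → E [⋀^Fin (k + 1)]→L[𝕜] W} {X : E → E} {y : E}
    (hτ : DifferentiableAt 𝕜 τ y) (hX : DifferentiableAt 𝕜 X y) (u : E) (v : Fin k → E) :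
    fderiv 𝕜 (fun z => (τ z).curryLeft (X z)) y u v =
      τ y (Matrix.vecCons (fderiv 𝕜 X y u) v) + fderiv 𝕜 τ y u (Matrix.vecCons (X y) v) := by
  let curry : E [⋀^Fin (k + 1)]→L[𝕜] W →L[𝕜] E →L[𝕜] E [⋀^Fin k]→L[𝕜] W :=
    ContinuousAlternatingMap.curryLeftLI.toContinuousLinearMap
  have hcurry : HasFDerivAt (fun z => (τ z).curryLeft) (curry ∘L fderiv 𝕜 τ y) y :=
    HasFDerivAt.comp (g := curry) y curry.hasFDerivAt hτ.hasFDerivAt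
  rw [(hcurry.clm_apply hX.hasFDerivAt).fderiv]
  rfl

/-- The coordinate expression `D_X τ (v₁, …, vₖ) + ∑ᵢ τ (v₁, …, DX vᵢ, …, vₖ)` of the Lie
derivative of a form on a vector space. -/
def coordLieDeriv (X : E → E) (τ : E → E [⋀^Fin k]→L[𝕜] W) (y : E) (v : Fin k → E) : W :=
  fderiv 𝕜 τ y (X y) v + ∑ i, τ y (Function.update v i (fderiv 𝕜 X y (v i)))

theorem coordLieDeriv_congr {X Y : E → E} {τ σ : E → E [⋀^Fin k]→L[𝕜] W} {y : E}
    (hX : X =ᶠ[nhds y] Y) (hτ : τ =ᶠ[nhds y] σ) (v : Fin k → E) :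
    coordLieDeriv X τ y v = coordLieDeriv Y σ y v := by
  rw [coordLieDeriv, coordLieDeriv, hX.fderiv_eq, hτ.fderiv_eq, hX.self_of_nhds, hτ.self_of_nhds]

theorem extDeriv_vecCons (τ : E → E [⋀^Fin (k + 1)]→L[𝕜] W) (y a : E) (v : Fin (k + 1) → E) :
    extDeriv τ y (Matrix.vecCons a v) = fderiv 𝕜 τ y a v -
      ∑ i : Fin (k + 1), (-1 : ℤ) ^ (i : ℕ) •
        fderiv 𝕜 τ y (v i) (Matrix.vecCons a (i.removeNth v)) := by
  have removeNth_succ (i : Fin (k + 1)) :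
      i.succ.removeNth (Matrix.vecCons a v) = Matrix.vecCons a (i.removeNth v) := by
    ext j
    refine Fin.cases ?_ (fun j => ?_) j <;> simp [Fin.removeNth]
  rw [extDeriv, ContinuousAlternatingMap.alternatizeUncurryFin_apply, Fin.sum_univ_succ,
    sub_eq_add_neg, ← Finset.sum_neg_distrib]
  congr 1
  · simp [Fin.removeNth_zero]
  · refine Finset.sum_congr rfl fun i _ => ?_
    rw [removeNth_succ, Fin.val_succ, pow_succ, mul_neg_one, neg_smul, Matrix.cons_val_succ]

theorem extDeriv_vecCons_zero (X : E → E) (τ : E → E [⋀^Fin 0]→L[𝕜] W) (y : E) (v : Fin 0 → E) :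
    extDeriv τ y (Matrix.vecCons (X y) v) = coordLieDeriv X τ y v := by
  rw [extDeriv, ContinuousAlternatingMap.alternatizeUncurryFin_apply, coordLieDeriv]
  simp [Fin.removeNth_zero]

theorem extDeriv_curryLeft_add {τ : E → E [⋀^Fin (k + 1)]→L[𝕜] W} {X : E → E} {y : E}
    (hτ : DifferentiableAt 𝕜 τ y) (hX : DifferentiableAt 𝕜 X y) (v : Fin (k + 1) → E) :
    extDeriv (fun z => (τ z).curryLeft (X z)) y v + extDeriv τ y (Matrix.vecCons (X y) v) =
      coordLieDeriv X τ y v := by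
  rw [extDeriv_vecCons, extDeriv, ContinuousAlternatingMap.alternatizeUncurryFin_apply,
    coordLieDeriv]
  simp only [fderiv_curryLeft_apply hτ hX, map_update_eq_vecCons_removeNth, smul_add,
    Finset.sum_add_distrib]
  abel

theorem coordLieDeriv_curryLeft {τ : E → E [⋀^Fin (k + 1)]→L[𝕜] W} {X Y : E → E} {y : E}
    (hτ : DifferentiableAt 𝕜 τ y) (hY : DifferentiableAt 𝕜 Y y) (v : Fin k → E) :
    coordLieDeriv X (fun z => (τ z).curryLeft (Y z)) y v =
      coordLieDeriv X τ y (Matrix.vecCons (Y y) v) +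
        τ y (Matrix.vecCons (VectorField.lieBracket 𝕜 X Y y) v) := by
  have hbracket : τ y (Matrix.vecCons (VectorField.lieBracket 𝕜 X Y y) v) =
      τ y (Matrix.vecCons (fderiv 𝕜 Y y (X y)) v) - τ y (Matrix.vecCons (fderiv 𝕜 X y (Y y)) v) :=
    congrArg (fun f => f v) (map_sub (τ y).curryLeft (fderiv 𝕜 Y y (X y)) (fderiv 𝕜 X y (Y y)))
  rw [coordLieDeriv, coordLieDeriv, fderiv_curryLeft_apply hτ hY, Fin.sum_univ_succ, hbracket]
  simp only [ContinuousAlternatingMap.curryLeft_apply_apply, update_vecCons_zero,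
    update_vecCons_succ, Matrix.cons_val_succ, Matrix.cons_val_zero]
  abel

theorem fderiv_lieBracket_of_related {F : Type*} [NormedAddCommGroup F] [NormedSpace 𝕜 F]
    {f : F → E} {V U : F → F} {X Y : E → E} {a : F} (hf : ContDiffAt 𝕜 (minSmoothness 𝕜 2) f a)
    (hV : DifferentiableAt 𝕜 V a) (hU : DifferentiableAt 𝕜 U a)
    (hX : DifferentiableAt 𝕜 X (f a)) (hY : DifferentiableAt 𝕜 Y (f a))
    (hVX : ∀ᶠ z in nhds a, fderiv 𝕜 f z (V z) = X (f z))
    (hUY : ∀ᶠ z in nhds a, fderiv 𝕜 f z (U z) = Y (f z)) :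
    fderiv 𝕜 f a (VectorField.lieBracket 𝕜 V U a) = VectorField.lieBracket 𝕜 X Y (f a) := by
  have hfa : DifferentiableAt 𝕜 f a :=
    (hf.of_le le_minSmoothness).differentiableAt two_ne_zero
  rw [VectorField.fderiv_apply_lieBracket hf le_rfl hU hV,
    Filter.EventuallyEq.fderiv_eq (f := fun z => Y (f z)) hUY,
    Filter.EventuallyEq.fderiv_eq (f := fun z => X (f z)) hVX,
    fderiv_fun_comp a hY hfa, fderiv_fun_comp a hX hfa]
  simp only [ContinuousLinearMap.comp_apply, hVX.self_of_nhds, hUY.self_of_nhds]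
  rfl

section Family

variable {P : Type*} [NormedAddCommGroup P] [NormedSpace 𝕜 P] {φ : P × E → E} {p : P} {y : E}

theorem fderiv_prodMk_right_apply (hφ : DifferentiableAt 𝕜 φ (p, y)) (v : E) :
    fderiv 𝕜 (fun z => φ (p, z)) y v = fderiv 𝕜 φ (p, y) (0, v) :=
  DFunLike.congr_fun (hφ.hasFDerivAt.comp y (hasFDerivAt_prodMk_right p y)).fderiv v

theorem fderiv_fderiv_prodMk_comm (hφ : ContDiffAt 𝕜 (minSmoothness 𝕜 2) φ (p, y)) (u : P)
    (v : E) :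
    fderiv 𝕜 (fun z => fderiv 𝕜 φ (p, z) (u, 0)) y v =
      fderiv 𝕜 (fun q => fderiv 𝕜 φ (q, y) (0, v)) p u := by
  have hφ' : HasFDerivAt (fderiv 𝕜 φ) (fderiv 𝕜 (fderiv 𝕜 φ) (p, y)) (p, y) :=
    (((hφ.of_le le_minSmoothness).fderiv_right (m := 1) le_rfl).differentiableAt
      one_ne_zero).hasFDerivAt
  have hleft : HasFDerivAt (fun z => fderiv 𝕜 φ (p, z)) _ y :=
    hφ'.comp y (hasFDerivAt_prodMk_right p y)
  have hright : HasFDerivAt (fun q => fderiv 𝕜 φ (q, y)) _ p :=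
    hφ'.comp p (hasFDerivAt_prodMk_left p y)
  rw [(hleft.clm_apply (hasFDerivAt_const (u, (0 : E)) y)).fderiv,
    (hright.clm_apply (hasFDerivAt_const ((0 : P), v) p)).fderiv]
  simpa using hφ.isSymmSndFDerivAt le_rfl (0, v) (u, 0)

theorem fderiv_pullback_family {τ : E → E [⋀^Fin k]→L[𝕜] W} (hτ : DifferentiableAt 𝕜 τ y)
    (hφ : ContDiffAt 𝕜 (minSmoothness 𝕜 2) φ (p, y)) (hid : ∀ᶠ z in nhds y, φ (p, z) = z)
    (u : P) (v : Fin k → E) :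
    fderiv 𝕜 (fun q => (τ (φ (q, y))).compContinuousLinearMap
        (fderiv 𝕜 (fun z => φ (q, z)) y) v) p u =
      coordLieDeriv (fun z => fderiv 𝕜 φ (p, z) (u, 0)) τ y v := by
  have hφ₂ : ContDiffAt 𝕜 2 φ (p, y) := hφ.of_le le_minSmoothness
  have hdiff : ∀ᶠ r in nhds (p, y), DifferentiableAt 𝕜 φ r :=
    (hφ₂.eventually (by simp)).mono fun r hr => hr.differentiableAt two_ne_zero
  have hslice := hasFDerivAt_prodMk_left (𝕜 := 𝕜) p y
  have hφy : φ (p, y) = y := hid.self_of_nhds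
  have hspace (w : E) : fderiv 𝕜 φ (p, y) (0, w) = w := by
    rw [← fderiv_prodMk_right_apply hdiff.self_of_nhds,
      Filter.EventuallyEq.fderiv_eq (f := fun z => z) hid, fderiv_fun_id,
      ContinuousLinearMap.id_apply]
  have hpullback : (fun q => (τ (φ (q, y))).compContinuousLinearMap
      (fderiv 𝕜 (fun z => φ (q, z)) y) v) =ᶠ[nhds p]
        fun q => τ (φ (q, y)) (fun i => fderiv 𝕜 φ (q, y) (0, v i)) := by
    filter_upwards [hslice.continuousAt.eventually hdiff] with q hq
    exact congrArg (τ (φ (q, y))) (funext fun i => fderiv_prodMk_right_apply hq (v i))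
  have hform : HasFDerivAt (fun q => τ (φ (q, y)))
      (fderiv 𝕜 τ y ∘L fderiv 𝕜 φ (p, y) ∘L ContinuousLinearMap.inl 𝕜 P E) p :=
    HasFDerivAt.comp (g := τ) p (hφy.symm ▸ hτ.hasFDerivAt)
      (hdiff.self_of_nhds.hasFDerivAt.comp p hslice)
  have hargs (i : Fin k) : HasFDerivAt (fun q => fderiv 𝕜 φ (q, y) (0, v i))
      (fderiv 𝕜 (fun q => fderiv 𝕜 φ (q, y) (0, v i)) p) p :=
    (((hφ₂.fderiv_right (m := 1) le_rfl).differentiableAt one_ne_zero).comp p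
      hslice.differentiableAt).clm_apply (differentiableAt_const _) |>.hasFDerivAt
  rw [hpullback.fderiv_eq, (hform.continuousAlternatingMap_apply hargs).fderiv, coordLieDeriv]
  simp [hspace, hφy, fderiv_fderiv_prodMk_comm hφ]

theorem coordLieDeriv_eq_zero_of_pullback {τ : E → E [⋀^Fin k]→L[𝕜] W}
    (hτ : DifferentiableAt 𝕜 τ y) (hφ : ContDiffAt 𝕜 (minSmoothness 𝕜 2) φ (p, y))
    (hid : ∀ᶠ z in nhds y, φ (p, z) = z)
    (hinv : ∀ᶠ q in nhds p, (τ (φ (q, y))).compContinuousLinearMap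
      (fderiv 𝕜 (fun z => φ (q, z)) y) = τ y) (u : P) (v : Fin k → E) :
    coordLieDeriv (fun z => fderiv 𝕜 φ (p, z) (u, 0)) τ y v = 0 := by
  have hconst : (fun q => (τ (φ (q, y))).compContinuousLinearMap
      (fderiv 𝕜 (fun z => φ (q, z)) y) v) =ᶠ[nhds p] fun _ => τ y v :=
    hinv.mono fun q hq => DFunLike.congr_fun hq v
  rw [← fderiv_pullback_family hτ hφ hid, hconst.fderiv_eq, fderiv_fun_const]
  rfl

end Family

end LocalCalculus

section ChartFields

variable {E : Type*} [NormedAddCommGroup E] [NormedSpace ℝ E]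
  {M : Type*} [TopologicalSpace M] [ChartedSpace E M] {k : ℕ}

/-- The expression of a vector field in the chart at `x₀`, the counterpart of `chartRep`. Outside
the target of the chart it is a junk value. -/
def chartField (x₀ : M) (X : ∀ x : M, TangentSpace 𝓘(ℝ, E) x) (y : E) : E :=
  mfderiv 𝓘(ℝ, E) 𝓘(ℝ, E) (extChartAt 𝓘(ℝ, E) x₀)
    ((extChartAt 𝓘(ℝ, E) x₀).symm y) (X ((extChartAt 𝓘(ℝ, E) x₀).symm y))

theorem chartField_extChartAt (X : ∀ x : M, TangentSpace 𝓘(ℝ, E) x) (x₀ : M) {z : M}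
    (hz : z ∈ (extChartAt 𝓘(ℝ, E) x₀).source) :
    chartField x₀ X (extChartAt 𝓘(ℝ, E) x₀ z) =
      mfderiv 𝓘(ℝ, E) 𝓘(ℝ, E) (extChartAt 𝓘(ℝ, E) x₀) z (X z) :=
  congrArg (fun p => (mfderiv 𝓘(ℝ, E) 𝓘(ℝ, E) (extChartAt 𝓘(ℝ, E) x₀) p (X p) : E))
    ((extChartAt 𝓘(ℝ, E) x₀).left_inv hz)

variable [IsManifold 𝓘(ℝ, E) ∞ M]

theorem mfderiv_extChartAt_self_apply (x : M) (v : E) :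
    mfderiv 𝓘(ℝ, E) 𝓘(ℝ, E) (extChartAt 𝓘(ℝ, E) x) x v = v := by
  rw [mfderiv_extChartAt_self]
  rfl

theorem mfderiv_extChartAt_symm_self_apply (x : M) (v : E) :
    mfderiv 𝓘(ℝ, E) 𝓘(ℝ, E) (extChartAt 𝓘(ℝ, E) x).symm (extChartAt 𝓘(ℝ, E) x x) v = v := by
  have h := mfderivWithin_range_extChartAt_symm (I := 𝓘(ℝ, E)) (x := x)
  rw [ModelWithCorners.range_eq_univ, mfderivWithin_univ] at h
  exact DFunLike.congr_fun h v

theorem mfderiv_extChartAt_symm_mfderiv_extChartAt (x₀ : M) {y : E}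
    (hy : y ∈ (extChartAt 𝓘(ℝ, E) x₀).target) (v : E) :
    mfderiv 𝓘(ℝ, E) 𝓘(ℝ, E) (extChartAt 𝓘(ℝ, E) x₀).symm y
      (mfderiv 𝓘(ℝ, E) 𝓘(ℝ, E) (extChartAt 𝓘(ℝ, E) x₀)
        ((extChartAt 𝓘(ℝ, E) x₀).symm y) v) = v := by
  have h := mfderivWithin_extChartAt_symm_comp_mfderiv_extChartAt (I := 𝓘(ℝ, E)) hy
  rw [ModelWithCorners.range_eq_univ, mfderivWithin_univ] at h
  exact DFunLike.congr_fun h v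

theorem chartField_self (X : ∀ x : M, TangentSpace 𝓘(ℝ, E) x) (x : M) :
    chartField x X (extChartAt 𝓘(ℝ, E) x x) = X x :=
  (chartField_extChartAt X x (mem_extChartAt_source x)).trans
    (mfderiv_extChartAt_self_apply (E := E) x (X x))

theorem chartRep_extChartAt (α : ∀ x : M, TangentSpace 𝓘(ℝ, E) x [⋀^Fin k]→L[ℝ] ℝ) (x₀ : M)
    {z : M} (hz : z ∈ (extChartAt 𝓘(ℝ, E) x₀).source) (w : Fin k → E) :
    chartRep x₀ α (extChartAt 𝓘(ℝ, E) x₀ z) (fun i =>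
      mfderiv 𝓘(ℝ, E) 𝓘(ℝ, E) (extChartAt 𝓘(ℝ, E) x₀) z (w i)) = α z w := by
  have hz' := (extChartAt 𝓘(ℝ, E) x₀).left_inv hz
  have hy := (extChartAt 𝓘(ℝ, E) x₀).map_source hz
  calc chartRep x₀ α (extChartAt 𝓘(ℝ, E) x₀ z) (fun i =>
        mfderiv 𝓘(ℝ, E) 𝓘(ℝ, E) (extChartAt 𝓘(ℝ, E) x₀) z (w i))
      = chartRep x₀ α (extChartAt 𝓘(ℝ, E) x₀ z) (fun i =>
          mfderiv 𝓘(ℝ, E) 𝓘(ℝ, E) (extChartAt 𝓘(ℝ, E) x₀)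
            ((extChartAt 𝓘(ℝ, E) x₀).symm (extChartAt 𝓘(ℝ, E) x₀ z)) (w i)) :=
        (congrArg (fun p => chartRep x₀ α (extChartAt 𝓘(ℝ, E) x₀ z) fun i =>
          (mfderiv 𝓘(ℝ, E) 𝓘(ℝ, E) (extChartAt 𝓘(ℝ, E) x₀) p (w i) : E)) hz').symm
    _ = α ((extChartAt 𝓘(ℝ, E) x₀).symm (extChartAt 𝓘(ℝ, E) x₀ z)) w :=
        congrArg (α _) (funext fun i => mfderiv_extChartAt_symm_mfderiv_extChartAt x₀ hy (w i))
    _ = α z w := congrArg (fun p => α p w) hz'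

theorem chartRep_self (α : ∀ x : M, TangentSpace 𝓘(ℝ, E) x [⋀^Fin k]→L[ℝ] ℝ) (x : M)
    (v : Fin k → E) : chartRep x α (extChartAt 𝓘(ℝ, E) x x) v = α x v := by
  rw [← chartRep_extChartAt α x (mem_extChartAt_source x) v]
  exact congrArg (chartRep x α _) (funext fun i => (mfderiv_extChartAt_self_apply x (v i)).symm)

theorem diffForm_ext_chartRep {α β : DiffForm E M k}
    (h : ∀ (x : M) (v : Fin k → E), chartRep x α.1 (extChartAt 𝓘(ℝ, E) x x) v =
      chartRep x β.1 (extChartAt 𝓘(ℝ, E) x x) v) : α = β := by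
  refine Subtype.ext (funext fun x => ContinuousAlternatingMap.ext fun v => ?_)
  exact (chartRep_self α.1 x v).symm.trans ((h x v).trans (chartRep_self β.1 x v))

theorem differentiableAt_chartField (X : VField E M) (x₀ : M) {y : E}
    (hy : y ∈ (extChartAt 𝓘(ℝ, E) x₀).target) : DifferentiableAt ℝ (chartField x₀ X) y :=
  ((contDiffOn_vectorField X x₀).contDiffAt (target_mem_nhds x₀ hy)).differentiableAt (by simp)

theorem chartRep_interior (X : VField E M) (α : DiffForm E M (k + 1)) (x₀ : M) {y : E}
    (hy : y ∈ (extChartAt 𝓘(ℝ, E) x₀).target) :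
    chartRep x₀ (interior k X α).1 y = (chartRep x₀ α.1 y).curryLeft (chartField x₀ X y) :=
  chartRep_interiorAt X α.1 x₀ hy

theorem chartRep_interior_eventuallyEq (X : VField E M) (α : DiffForm E M (k + 1))
    (x₀ : M) {y : E} (hy : y ∈ (extChartAt 𝓘(ℝ, E) x₀).target) :
    chartRep x₀ (interior k X α).1 =ᶠ[nhds y]
      fun z => (chartRep x₀ α.1 z).curryLeft (chartField x₀ X z) := by
  filter_upwards [target_mem_nhds x₀ hy] with z hz using chartRep_interior X α x₀ hz

theorem chartRep_lieDer (X : VField E M) (α : DiffForm E M k) (x₀ : M) {y : E}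
    (hy : y ∈ (extChartAt 𝓘(ℝ, E) x₀).target) (v : Fin k → E) :
    chartRep x₀ (lieDer k X α).1 y v =
      coordLieDeriv (chartField x₀ X) (chartRep x₀ α.1) y v := by
  cases k with
  | zero =>
    rw [← extDeriv_vecCons_zero, ← chartRep_extDerivAt α x₀ hy]
    exact DFunLike.congr_fun (chartRep_interior X (extDer 0 α) x₀ hy) v
  | succ k =>
    rw [← extDeriv_curryLeft_add (differentiableAt_chartRep α x₀ hy)
      (differentiableAt_chartField X x₀ hy), ← chartRep_extDerivAt α x₀ hy,
      ← (chartRep_interior_eventuallyEq X α x₀ hy).extDeriv_eq,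
      ← chartRep_extDerivAt (interior k X α) x₀ hy]
    exact congrArg _ (DFunLike.congr_fun (chartRep_interior X (extDer (k + 1) α) x₀ hy) v)

theorem interior_interior_self (X : VField E M) (α : DiffForm E M (k + 2)) :
    interior k X (interior (k + 1) X α) = 0 :=
  Subtype.ext (funext fun x => ContinuousAlternatingMap.curryLeft_same (E := E) (α.1 x) (X x))

theorem mpullbackWithin_extChartAt_symm_eventuallyEq (X : ∀ x : M, TangentSpace 𝓘(ℝ, E) x)
    (x : M) :
    VectorField.mpullbackWithin 𝓘(ℝ, E) 𝓘(ℝ, E) (extChartAt 𝓘(ℝ, E) x).symm X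
      (Set.range 𝓘(ℝ, E)) =ᶠ[nhds (extChartAt 𝓘(ℝ, E) x x)] chartField x X := by
  filter_upwards [extChartAt_target_mem_nhds (I := 𝓘(ℝ, E)) x] with z hz
  have hinverse := ContinuousLinearMap.inverse_eq
    (mfderivWithin_extChartAt_symm_comp_mfderiv_extChartAt (I := 𝓘(ℝ, E)) hz)
    (mfderiv_extChartAt_comp_mfderivWithin_extChartAt_symm (I := 𝓘(ℝ, E)) hz)
  exact DFunLike.congr_fun hinverse _

theorem mlieBracket_eq_lieBracket_chartField (X Y : ∀ x : M, TangentSpace 𝓘(ℝ, E) x) (x : M) :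
    VectorField.mlieBracket 𝓘(ℝ, E) X Y x =
      VectorField.lieBracket ℝ (chartField x X) (chartField x Y) (extChartAt 𝓘(ℝ, E) x x) := by
  rw [← (mpullbackWithin_extChartAt_symm_eventuallyEq X x).lieBracket_vectorField_eq
    (mpullbackWithin_extChartAt_symm_eventuallyEq Y x), ← VectorField.mlieBracketWithin_univ,
    VectorField.mlieBracketWithin_apply]
  have hinverse {A : E →L[ℝ] E} (hA : A = ContinuousLinearMap.id ℝ E) (w : E) :
      A.inverse w = w := by
    rw [hA, ContinuousLinearMap.inverse_id]
    rfl
  refine (hinverse mfderiv_extChartAt_self _).trans ?_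
  rw [Set.preimage_univ, Set.univ_inter]
  refine VectorField.lieBracketWithin_of_mem_nhds ?_
  rw [ModelWithCorners.range_eq_univ]
  exact Filter.univ_mem

theorem differentiableAt_chartField_of_mdifferentiableAt [CompleteSpace E]
    {X : ∀ x : M, TangentSpace 𝓘(ℝ, E) x} {x : M}
    (hX : MDifferentiableAt 𝓘(ℝ, E) 𝓘(ℝ, E).tangent
      (fun x => (⟨x, X x⟩ : TangentBundle 𝓘(ℝ, E) M)) x) :
    DifferentiableAt ℝ (chartField x X) (extChartAt 𝓘(ℝ, E) x x) := by
  have : IsManifold 𝓘(ℝ, E) 3 M := IsManifold.of_le (n := ∞) ENat.LEInfty.out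
  have h := (mdifferentiableWithinAt_univ.2 hX).differentiableWithinAt_mpullbackWithin_vectorField
  refine (mpullbackWithin_extChartAt_symm_eventuallyEq X x).differentiableAt_iff.1
    (h.differentiableAt ?_)
  rw [Set.preimage_univ, Set.univ_inter, ModelWithCorners.range_eq_univ]
  exact Filter.univ_mem

theorem lieDer_interior {X Y Z : VField E M} (α : DiffForm E M (k + 1))
    (hZ : ∀ x : M, VectorField.mlieBracket 𝓘(ℝ, E) X Y x = Z x) :
    lieDer k X (interior k Y α) = interior k Y (lieDer (k + 1) X α) + interior k Z α := by
  refine diffForm_ext_chartRep fun x v => ?_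
  have hx := mem_extChartAt_target (I := 𝓘(ℝ, E)) x
  rw [chartRep_lieDer _ _ _ hx,
    coordLieDeriv_congr Filter.EventuallyEq.rfl (chartRep_interior_eventuallyEq Y α x hx),
    coordLieDeriv_curryLeft (differentiableAt_chartRep α x hx) (differentiableAt_chartField Y x hx),
    ← chartRep_lieDer _ _ _ hx, ← mlieBracket_eq_lieBracket_chartField, hZ, ← chartField_self Z x,
    Submodule.coe_add, chartRep_add, Pi.add_apply, chartRep_interior _ _ _ hx,
    chartRep_interior _ _ _ hx]
  rfl

end ChartFields

section MapsInCharts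

variable {E : Type*} [NormedAddCommGroup E] [NormedSpace ℝ E]
  {M : Type*} [TopologicalSpace M] [ChartedSpace E M] [IsManifold 𝓘(ℝ, E) ∞ M]
  {F : Type*} [NormedAddCommGroup F] [NormedSpace ℝ F]
  {N : Type*} [TopologicalSpace N] [ChartedSpace F N] [IsManifold 𝓘(ℝ, F) ∞ N]

theorem contDiffAt_mapInCharts {f : N → M} (hf : ContMDiff 𝓘(ℝ, F) 𝓘(ℝ, E) ∞ f) (p₀ : N)
    (x₀ : M) {s : F} (hs : s ∈ (extChartAt 𝓘(ℝ, F) p₀).target)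
    (hfs : f ((extChartAt 𝓘(ℝ, F) p₀).symm s) ∈ (extChartAt 𝓘(ℝ, E) x₀).source) :
    ContDiffAt ℝ ∞
      (fun s => extChartAt 𝓘(ℝ, E) x₀ (f ((extChartAt 𝓘(ℝ, F) p₀).symm s))) s := by
  have hchart : ContMDiffAt 𝓘(ℝ, E) 𝓘(ℝ, E) ∞ (extChartAt 𝓘(ℝ, E) x₀)
      (f ((extChartAt 𝓘(ℝ, F) p₀).symm s)) :=
    contMDiffAt_extChartAt' (by rwa [extChartAt_source] at hfs)
  have hsymm : ContMDiffAt 𝓘(ℝ, F) 𝓘(ℝ, F) ∞ (extChartAt 𝓘(ℝ, F) p₀).symm s :=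
    (contMDiffOn_extChartAt_symm p₀).contMDiffAt (target_mem_nhds p₀ hs)
  exact (hchart.comp s (hf.contMDiffAt.comp s hsymm)).contDiffAt

theorem fderiv_mapInCharts_apply {f : N → M} (hf : ContMDiff 𝓘(ℝ, F) 𝓘(ℝ, E) ∞ f) (p₀ : N)
    (x₀ : M) {s : F} (hs : s ∈ (extChartAt 𝓘(ℝ, F) p₀).target)
    (hfs : f ((extChartAt 𝓘(ℝ, F) p₀).symm s) ∈ (extChartAt 𝓘(ℝ, E) x₀).source) (u : F) :
    fderiv ℝ (fun s => extChartAt 𝓘(ℝ, E) x₀ (f ((extChartAt 𝓘(ℝ, F) p₀).symm s))) s u =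
      mfderiv 𝓘(ℝ, E) 𝓘(ℝ, E) (extChartAt 𝓘(ℝ, E) x₀) (f ((extChartAt 𝓘(ℝ, F) p₀).symm s))
        (mfderiv 𝓘(ℝ, F) 𝓘(ℝ, E) f ((extChartAt 𝓘(ℝ, F) p₀).symm s)
          (mfderiv 𝓘(ℝ, F) 𝓘(ℝ, F) (extChartAt 𝓘(ℝ, F) p₀).symm s u)) := by
  have hchart : MDifferentiableAt 𝓘(ℝ, E) 𝓘(ℝ, E) (extChartAt 𝓘(ℝ, E) x₀)
      (f ((extChartAt 𝓘(ℝ, F) p₀).symm s)) :=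
    mdifferentiableAt_extChartAt (by rwa [extChartAt_source] at hfs)
  have hf' := hf.mdifferentiableAt (x := (extChartAt 𝓘(ℝ, F) p₀).symm s) (by simp)
  have hcomp := hchart.hasMFDerivAt.comp s (hf'.hasMFDerivAt.comp s
    (mdifferentiableAt_symm p₀ hs).hasMFDerivAt)
  rw [← mfderiv_eq_fderiv]
  exact DFunLike.congr_fun hcomp.mfderiv u

theorem fderiv_mapInCharts_chartField {f : N → M} (hf : ContMDiff 𝓘(ℝ, F) 𝓘(ℝ, E) ∞ f) (p₀ : N)
    (x₀ : M) {V : ∀ p : N, TangentSpace 𝓘(ℝ, F) p} {X : ∀ x : M, TangentSpace 𝓘(ℝ, E) x}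
    (hVX : ∀ p, mfderiv 𝓘(ℝ, F) 𝓘(ℝ, E) f p (V p) = X (f p)) {s : F}
    (hs : s ∈ (extChartAt 𝓘(ℝ, F) p₀).target)
    (hfs : f ((extChartAt 𝓘(ℝ, F) p₀).symm s) ∈ (extChartAt 𝓘(ℝ, E) x₀).source) :
    fderiv ℝ (fun s => extChartAt 𝓘(ℝ, E) x₀ (f ((extChartAt 𝓘(ℝ, F) p₀).symm s))) s
      (chartField p₀ V s) = chartField x₀ X
        (extChartAt 𝓘(ℝ, E) x₀ (f ((extChartAt 𝓘(ℝ, F) p₀).symm s))) := by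
  rw [fderiv_mapInCharts_apply hf p₀ x₀ hs hfs, chartField_extChartAt X x₀ hfs, ← hVX]
  exact congrArg (fun u => (mfderiv 𝓘(ℝ, E) 𝓘(ℝ, E) (extChartAt 𝓘(ℝ, E) x₀) _
    (mfderiv 𝓘(ℝ, F) 𝓘(ℝ, E) f _ u) : E))
    (mfderiv_extChartAt_symm_mfderiv_extChartAt p₀ hs _)

theorem fderiv_mapInCharts_self_apply {f : N → M} (hf : ContMDiff 𝓘(ℝ, F) 𝓘(ℝ, E) ∞ f) (p : N)
    (u : F) :
    fderiv ℝ (fun s => extChartAt 𝓘(ℝ, E) (f p) (f ((extChartAt 𝓘(ℝ, F) p).symm s)))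
      (extChartAt 𝓘(ℝ, F) p p) u = mfderiv 𝓘(ℝ, F) 𝓘(ℝ, E) f p u := by
  have hp := extChartAt_to_inv (I := 𝓘(ℝ, F)) p
  rw [fderiv_mapInCharts_apply hf p (f p) (mem_extChartAt_target p)
    (by rw [hp]; exact mem_extChartAt_source (f p)), mfderiv_extChartAt_symm_self_apply]
  refine (congrArg (fun q => (mfderiv 𝓘(ℝ, E) 𝓘(ℝ, E) (extChartAt 𝓘(ℝ, E) (f p)) (f q)
    (mfderiv 𝓘(ℝ, F) 𝓘(ℝ, E) f q u) : E)) hp).trans ?_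
  exact mfderiv_extChartAt_self_apply (f p) _

theorem mfderiv_mlieBracket_of_related [CompleteSpace E] [CompleteSpace F]
    {f : N → M} (hf : ContMDiff 𝓘(ℝ, F) 𝓘(ℝ, E) ∞ f)
    {V W : ∀ p : N, TangentSpace 𝓘(ℝ, F) p} {X Y : ∀ x : M, TangentSpace 𝓘(ℝ, E) x} {p : N}
    (hV : MDifferentiableAt 𝓘(ℝ, F) 𝓘(ℝ, F).tangent
      (fun q => (⟨q, V q⟩ : TangentBundle 𝓘(ℝ, F) N)) p)
    (hW : MDifferentiableAt 𝓘(ℝ, F) 𝓘(ℝ, F).tangent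
      (fun q => (⟨q, W q⟩ : TangentBundle 𝓘(ℝ, F) N)) p)
    (hX : MDifferentiableAt 𝓘(ℝ, E) 𝓘(ℝ, E).tangent
      (fun x => (⟨x, X x⟩ : TangentBundle 𝓘(ℝ, E) M)) (f p))
    (hY : MDifferentiableAt 𝓘(ℝ, E) 𝓘(ℝ, E).tangent
      (fun x => (⟨x, Y x⟩ : TangentBundle 𝓘(ℝ, E) M)) (f p))
    (hVX : ∀ q, mfderiv 𝓘(ℝ, F) 𝓘(ℝ, E) f q (V q) = X (f q))
    (hWY : ∀ q, mfderiv 𝓘(ℝ, F) 𝓘(ℝ, E) f q (W q) = Y (f q)) :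
    mfderiv 𝓘(ℝ, F) 𝓘(ℝ, E) f p (VectorField.mlieBracket 𝓘(ℝ, F) V W p) =
      VectorField.mlieBracket 𝓘(ℝ, E) X Y (f p) := by
  set g : F → E := fun s => extChartAt 𝓘(ℝ, E) (f p) (f ((extChartAt 𝓘(ℝ, F) p).symm s)) with hg
  set a : F := extChartAt 𝓘(ℝ, F) p p with ha
  have hga : g a = extChartAt 𝓘(ℝ, E) (f p) (f p) := by
    rw [hg, ha]
    exact congrArg (fun q => extChartAt 𝓘(ℝ, E) (f p) (f q)) (extChartAt_to_inv p)
  have hsource : f ((extChartAt 𝓘(ℝ, F) p).symm a) ∈ (extChartAt 𝓘(ℝ, E) (f p)).source := by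
    rw [ha, extChartAt_to_inv]
    exact mem_extChartAt_source (f p)
  have hnear : ∀ᶠ s in nhds a, s ∈ (extChartAt 𝓘(ℝ, F) p).target ∧
      f ((extChartAt 𝓘(ℝ, F) p).symm s) ∈ (extChartAt 𝓘(ℝ, E) (f p)).source := by
    have hcont := hf.continuous.continuousAt.comp (continuousAt_extChartAt_symm (I := 𝓘(ℝ, F)) p)
    exact Filter.Eventually.and (extChartAt_target_mem_nhds p)
      (hcont.eventually ((isOpen_extChartAt_source (f p)).mem_nhds hsource))
  have hsmooth : ContDiffAt ℝ ∞ g a :=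
    contDiffAt_mapInCharts hf p (f p) (mem_extChartAt_target p) hsource
  have hbracket := fderiv_lieBracket_of_related (f := g) (a := a)
    (hsmooth.of_le (by rw [minSmoothness_of_isRCLikeNormedField]; exact ENat.LEInfty.out))
    (differentiableAt_chartField_of_mdifferentiableAt hV)
    (differentiableAt_chartField_of_mdifferentiableAt hW)
    (by rw [hga]; exact differentiableAt_chartField_of_mdifferentiableAt hX)
    (by rw [hga]; exact differentiableAt_chartField_of_mdifferentiableAt hY)
    (hnear.mono fun s hs => fderiv_mapInCharts_chartField hf p (f p) hVX hs.1 hs.2)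
    (hnear.mono fun s hs => fderiv_mapInCharts_chartField hf p (f p) hWY hs.1 hs.2)
  rw [hga, ← mlieBracket_eq_lieBracket_chartField, ← mlieBracket_eq_lieBracket_chartField]
    at hbracket
  exact (fderiv_mapInCharts_self_apply hf p _).symm.trans hbracket

end MapsInCharts

section LieGroup

variable {F : Type*} [NormedAddCommGroup F] [NormedSpace ℝ F]
  {G : Type*} [TopologicalSpace G] [ChartedSpace F G] [Group G]
  [LieGroup 𝓘(ℝ, F) ∞ G]

theorem mfderiv_inv_one_apply (ξ : F) :
    (mfderiv 𝓘(ℝ, F) 𝓘(ℝ, F) (fun g : G => g⁻¹) 1 ξ : F) = -ξ := by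
  let div : G × G → G := fun p => p.1⁻¹ * p.2
  have hdiv : MDifferentiableAt (𝓘(ℝ, F).prod 𝓘(ℝ, F)) 𝓘(ℝ, F) div ((1 : G), (1 : G)) :=
    (((contMDiff_inv 𝓘(ℝ, F) ∞).comp contMDiff_fst).mul contMDiff_snd).mdifferentiableAt (by simp)
  have hdiag : HasMFDerivAt 𝓘(ℝ, F) (𝓘(ℝ, F).prod 𝓘(ℝ, F)) (fun g : G => (g, g)) 1
      ((ContinuousLinearMap.id ℝ F).prod (ContinuousLinearMap.id ℝ F)) :=
    (hasMFDerivAt_id (1 : G)).prodMk (hasMFDerivAt_id (1 : G))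
  have hcomp := HasMFDerivAt.comp (f := fun g : G => (g, g)) (g := div) (1 : G)
    hdiv.hasMFDerivAt hdiag
  have hconst : div ∘ (fun g : G => (g, g)) = fun _ => 1 := funext fun g => inv_mul_cancel g
  rw [hconst] at hcomp
  have hzero : (mfderiv (𝓘(ℝ, F).prod 𝓘(ℝ, F)) 𝓘(ℝ, F) div ((1 : G), (1 : G)) (ξ, ξ) : F) = 0 :=
    DFunLike.congr_fun (hasMFDerivAt_unique hcomp (hasMFDerivAt_const 1 (1 : G))) ξ
  have hadd : (0 : F) = mfderiv 𝓘(ℝ, F) 𝓘(ℝ, F) (fun g : G => div (g, 1)) 1 ξ +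
      mfderiv 𝓘(ℝ, F) 𝓘(ℝ, F) (fun g : G => div (1, g)) 1 ξ :=
    hzero.symm.trans (mfderiv_prod_eq_add_apply (v := ((ξ : TangentSpace 𝓘(ℝ, F) (1 : G)),
      (ξ : TangentSpace 𝓘(ℝ, F) (1 : G)))) hdiv)
  have hleft : (fun g : G => div (g, 1)) = fun g => g⁻¹ := funext fun g => mul_one g⁻¹
  have hright : (fun g : G => div (1, g)) = id := funext fun g => by simp [div]
  rw [hleft, hright, mfderiv_id] at hadd
  exact eq_neg_of_add_eq_zero_left hadd.symm

end LieGroup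

section GroupAction

variable {E : Type*} [NormedAddCommGroup E] [NormedSpace ℝ E]
  {M : Type*} [TopologicalSpace M] [ChartedSpace E M]
  {F : Type*} [NormedAddCommGroup F] [NormedSpace ℝ F]
  {G : Type*} [TopologicalSpace G] [ChartedSpace F G] [Group G]
  [MulAction G M] [ContMDiffSMul 𝓘(ℝ, F) 𝓘(ℝ, E) ∞ G M]

variable (E F) in
theorem contMDiff_orbit (z : M) : ContMDiff 𝓘(ℝ, F) 𝓘(ℝ, E) ∞ (fun g : G => g • z) :=
  ContMDiffSMul.contMDiff_smul.comp (contMDiff_id.prodMk contMDiff_const)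

variable [LieGroup 𝓘(ℝ, F) ∞ G]

variable (E F) in
theorem contMDiff_inv_smul (z : M) :
    ContMDiff 𝓘(ℝ, F) 𝓘(ℝ, E) ∞ (fun g : G => g⁻¹ • z) :=
  (contMDiff_orbit E F z).comp (contMDiff_inv 𝓘(ℝ, F) ∞)

theorem mfderiv_inv_smul_one_apply (z : M) (ξ : GroupLieAlgebra 𝓘(ℝ, F) G) :
    (mfderiv 𝓘(ℝ, F) 𝓘(ℝ, E) (fun g : G => g⁻¹ • z) 1 ξ : E) = infGenAt E F G z (-ξ) := by
  have hcomp := HasMFDerivAt.comp (I := 𝓘(ℝ, F)) (1 : G)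
    ((contMDiff_orbit E F z).mdifferentiableAt (by simp)).hasMFDerivAt
    ((contMDiff_inv 𝓘(ℝ, F) ∞).mdifferentiableAt (by simp)).hasMFDerivAt
  refine (DFunLike.congr_fun hcomp.mfderiv ξ).trans ?_
  refine (congrArg (mfderiv 𝓘(ℝ, F) 𝓘(ℝ, E) (fun g : G => g • z) (1⁻¹ : G))
    (mfderiv_inv_one_apply (F := F) (G := G) ξ)).trans ?_
  exact congrArg (fun g : G => (mfderiv 𝓘(ℝ, F) 𝓘(ℝ, E) (fun g : G => g • z) g (-ξ) : E)) inv_one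

theorem mfderiv_inv_smul_mulInvariantVectorField (z : M) (ξ : GroupLieAlgebra 𝓘(ℝ, F) G) (g : G) :
    (mfderiv 𝓘(ℝ, F) 𝓘(ℝ, E) (fun h : G => h⁻¹ • z) g (mulInvariantVectorField ξ g) : E) =
      infGenAt E F G (g⁻¹ • z) (-ξ) := by
  have hcomp := HasMFDerivAt.comp (1 : G)
    ((contMDiff_inv_smul E F z).mdifferentiableAt (by simp)).hasMFDerivAt
    ((contMDiff_mul_left (a := g)).mdifferentiableAt (I := 𝓘(ℝ, F)) (n := ∞)
      (by simp)).hasMFDerivAt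
  have htranslate : (fun h : G => h⁻¹ • z) ∘ (fun h : G => g * h) =
      fun h : G => h⁻¹ • (g⁻¹ • z) := by
    funext h
    simp [mul_smul]
  rw [htranslate] at hcomp
  rw [← mfderiv_inv_smul_one_apply, hcomp.mfderiv]
  exact congrArg (fun h : G => (mfderiv 𝓘(ℝ, F) 𝓘(ℝ, E) (fun h : G => h⁻¹ • z) h
    (mulInvariantVectorField ξ g : F) : E)) (mul_one g).symm

theorem mlieBracket_infGen [IsManifold 𝓘(ℝ, E) ∞ M] [CompleteSpace E] [CompleteSpace F]
    (ξ η : GroupLieAlgebra 𝓘(ℝ, F) G) (x : M) :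
    VectorField.mlieBracket 𝓘(ℝ, E) (infGen E M F G ξ) (infGen E M F G η) x =
      infGen E M F G (-⁅ξ, η⁆) x := by
  have hdiff (ζ : GroupLieAlgebra 𝓘(ℝ, F) G) := (infGen E M F G ζ).contMDiff
  have hrelated := mfderiv_mlieBracket_of_related (p := (1 : G)) (contMDiff_inv_smul E F x)
    (mdifferentiableAt_mulInvariantVectorField (-ξ))
    (mdifferentiableAt_mulInvariantVectorField (-η))
    ((hdiff ξ).mdifferentiableAt (by simp)) ((hdiff η).mdifferentiableAt (by simp))
    (fun g => (mfderiv_inv_smul_mulInvariantVectorField x (-ξ) g).trans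
      (congrArg (infGenAt E F G (g⁻¹ • x)) (neg_neg ξ)))
    (fun g => (mfderiv_inv_smul_mulInvariantVectorField x (-η) g).trans
      (congrArg (infGenAt E F G (g⁻¹ • x)) (neg_neg η)))
  rw [← GroupLieAlgebra.bracket_def, neg_lie, lie_neg, neg_neg] at hrelated
  refine Eq.trans ?_ (hrelated.symm.trans (mfderiv_inv_smul_one_apply x _))
  exact congrArg (fun z => (VectorField.mlieBracket 𝓘(ℝ, E) (infGen E M F G ξ)
    (infGen E M F G η) z : E)) (show x = (1 : G)⁻¹ • x by rw [inv_one, one_smul])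

end GroupAction

section Invariance

variable {E : Type*} [NormedAddCommGroup E] [NormedSpace ℝ E]
  {M : Type*} [TopologicalSpace M] [ChartedSpace E M]
  {F : Type*} [NormedAddCommGroup F] [NormedSpace ℝ F]
  {G : Type*} [TopologicalSpace G] [ChartedSpace F G] [Group G] [MulAction G M]

variable (E F G) in
/-- The action map `G × M → M` near `(1, x)`, in the charts at `1` and `x`. -/
def actionInCharts (x : M) (p : F × E) : E :=
  extChartAt 𝓘(ℝ, E) x
    ((extChartAt 𝓘(ℝ, F) (1 : G)).symm p.1 • (extChartAt 𝓘(ℝ, E) x).symm p.2)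

theorem actionInCharts_one (x : M) {z : E} (hz : z ∈ (extChartAt 𝓘(ℝ, E) x).target) :
    actionInCharts E F G x (extChartAt 𝓘(ℝ, F) (1 : G) 1, z) = z := by
  rw [actionInCharts, extChartAt_to_inv, one_smul, (extChartAt 𝓘(ℝ, E) x).right_inv hz]

variable [IsManifold 𝓘(ℝ, E) ∞ M] [ContMDiffSMul 𝓘(ℝ, F) 𝓘(ℝ, E) ∞ G M]

theorem PreservesForm.eventually_pullback_actionInCharts {k : ℕ} {Ω : DiffForm E M k}
    (hG : PreservesForm G Ω) (x : M) :
    ∀ᶠ s in nhds (extChartAt 𝓘(ℝ, F) (1 : G) 1),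
      (chartRep x Ω.1 (actionInCharts E F G x (s, extChartAt 𝓘(ℝ, E) x x))).compContinuousLinearMap
        (fderiv ℝ (fun z => actionInCharts E F G x (s, z)) (extChartAt 𝓘(ℝ, E) x x)) =
      chartRep x Ω.1 (extChartAt 𝓘(ℝ, E) x x) := by
  have hcont : ContinuousAt (fun s => (extChartAt 𝓘(ℝ, F) (1 : G)).symm s •
      (extChartAt 𝓘(ℝ, E) x).symm (extChartAt 𝓘(ℝ, E) x x)) (extChartAt 𝓘(ℝ, F) (1 : G) 1) :=
    ContinuousAt.comp (g := fun g : G => g • _)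
      (contMDiff_orbit E F _).continuous.continuousAt (continuousAt_extChartAt_symm 1)
  have hsource : ∀ᶠ s in nhds (extChartAt 𝓘(ℝ, F) (1 : G) 1),
      (extChartAt 𝓘(ℝ, F) (1 : G)).symm s • (extChartAt 𝓘(ℝ, E) x).symm
        (extChartAt 𝓘(ℝ, E) x x) ∈ (extChartAt 𝓘(ℝ, E) x).source := by
    refine hcont.eventually ((isOpen_extChartAt_source x).mem_nhds ?_)
    beta_reduce
    rw [extChartAt_to_inv, extChartAt_to_inv, one_smul]
    exact mem_extChartAt_source x
  filter_upwards [hsource] with s hs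
  ext w
  set g := (extChartAt 𝓘(ℝ, F) (1 : G)).symm s
  have hg : ContMDiff 𝓘(ℝ, E) 𝓘(ℝ, E) ∞ (fun y : M => g • y) :=
    (ContMDiffSMul.contMDiff_smul (I := 𝓘(ℝ, F))).comp (contMDiff_const.prodMk contMDiff_id)
  refine Eq.trans ?_ (DFunLike.congr_fun
    (hG g ((extChartAt 𝓘(ℝ, E) x).symm (extChartAt 𝓘(ℝ, E) x x))) _)
  refine Eq.trans ?_ (chartRep_extChartAt Ω.1 x hs _)
  exact congrArg (chartRep x Ω.1 _) (funext fun i =>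
    fderiv_mapInCharts_apply hg x x (mem_extChartAt_target x) hs (w i))

variable [LieGroup 𝓘(ℝ, F) ∞ G]

theorem contDiffAt_actionInCharts (x : M) {z : E} (hz : z ∈ (extChartAt 𝓘(ℝ, E) x).target) :
    ContDiffAt ℝ ∞ (actionInCharts E F G x) (extChartAt 𝓘(ℝ, F) (1 : G) 1, z) := by
  set p := (extChartAt 𝓘(ℝ, F) (1 : G) 1, z) with hp
  have hgroup : ContMDiffAt 𝓘(ℝ, F × E) 𝓘(ℝ, F) ∞
      (fun p : F × E => (extChartAt 𝓘(ℝ, F) (1 : G)).symm p.1) p :=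
    ContMDiffAt.comp (g := (extChartAt 𝓘(ℝ, F) (1 : G)).symm) p
      ((contMDiffOn_extChartAt_symm 1).contMDiffAt (target_mem_nhds 1 (mem_extChartAt_target 1)))
      contDiff_fst.contMDiff.contMDiffAt
  have hpoint : ContMDiffAt 𝓘(ℝ, F × E) 𝓘(ℝ, E) ∞
      (fun p : F × E => (extChartAt 𝓘(ℝ, E) x).symm p.2) p :=
    ContMDiffAt.comp (g := (extChartAt 𝓘(ℝ, E) x).symm) p
      ((contMDiffOn_extChartAt_symm x).contMDiffAt (target_mem_nhds x hz))
      contDiff_snd.contMDiff.contMDiffAt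
  have hsource : (extChartAt 𝓘(ℝ, F) (1 : G)).symm p.1 • (extChartAt 𝓘(ℝ, E) x).symm p.2 ∈
      (chartAt E x).source := by
    rw [hp, extChartAt_to_inv, one_smul, ← extChartAt_source 𝓘(ℝ, E)]
    exact (extChartAt 𝓘(ℝ, E) x).map_target hz
  exact (ContMDiffAt.comp (g := extChartAt 𝓘(ℝ, E) x) p (contMDiffAt_extChartAt' hsource)
    (hgroup.smul hpoint)).contDiffAt

theorem fderiv_actionInCharts (x : M) (ξ : F) {z : E}
    (hz : z ∈ (extChartAt 𝓘(ℝ, E) x).target) :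
    fderiv ℝ (actionInCharts E F G x) (extChartAt 𝓘(ℝ, F) (1 : G) 1, z) (ξ, 0) =
      chartField x (infGen E M F G ξ) z := by
  set z' := (extChartAt 𝓘(ℝ, E) x).symm z
  set e := extChartAt 𝓘(ℝ, F) (1 : G) 1
  have hinv : (extChartAt 𝓘(ℝ, F) (1 : G)).symm e = 1 := extChartAt_to_inv 1
  have hsource : (extChartAt 𝓘(ℝ, F) (1 : G)).symm e • z' ∈ (extChartAt 𝓘(ℝ, E) x).source := by
    rw [hinv, one_smul]
    exact (extChartAt 𝓘(ℝ, E) x).map_target hz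
  have hpartial := (HasFDerivAt.comp (f := fun s => (s, z)) e
    ((contDiffAt_actionInCharts (G := G) x hz).differentiableAt (by simp)).hasFDerivAt
    (hasFDerivAt_prodMk_left e z)).fderiv
  refine (DFunLike.congr_fun hpartial ξ).symm.trans ?_
  refine (fderiv_mapInCharts_apply (contMDiff_orbit E F z') 1 x (mem_extChartAt_target 1)
    hsource ξ).trans ?_
  rw [mfderiv_extChartAt_symm_self_apply]
  refine (congrArg (fun g : G => (mfderiv 𝓘(ℝ, E) 𝓘(ℝ, E) (extChartAt 𝓘(ℝ, E) x) (g • z')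
    (mfderiv 𝓘(ℝ, F) 𝓘(ℝ, E) (fun g : G => g • z') g ξ) : E)) hinv).trans ?_
  exact congrArg (fun q => (mfderiv 𝓘(ℝ, E) 𝓘(ℝ, E) (extChartAt 𝓘(ℝ, E) x) q
    (infGenAt E F G z' ξ : E) : E)) (one_smul G z')

theorem lieDer_infGen_eq_zero {k : ℕ} {Ω : DiffForm E M k} (hG : PreservesForm G Ω)
    (ξ : GroupLieAlgebra 𝓘(ℝ, F) G) : lieDer k (infGen E M F G ξ) Ω = 0 := by
  refine diffForm_ext_chartRep fun x v => ?_
  have hx := mem_extChartAt_target (I := 𝓘(ℝ, E)) x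
  have hfield : chartField x (infGen E M F G ξ) =ᶠ[nhds (extChartAt 𝓘(ℝ, E) x x)]
      fun z => fderiv ℝ (actionInCharts E F G x) (extChartAt 𝓘(ℝ, F) (1 : G) 1, z) (ξ, 0) := by
    filter_upwards [extChartAt_target_mem_nhds x] with z hz
    exact (fderiv_actionInCharts (F := F) x ξ hz).symm
  rw [chartRep_lieDer _ _ _ hx, coordLieDeriv_congr hfield Filter.EventuallyEq.rfl]
  exact coordLieDeriv_eq_zero_of_pullback (P := F) (differentiableAt_chartRep Ω x hx)
    ((contDiffAt_actionInCharts (F := F) (G := G) x hx).of_le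
      (by rw [minSmoothness_of_isRCLikeNormedField]; exact ENat.LEInfty.out))
    (Filter.mem_of_superset (extChartAt_target_mem_nhds x)
      fun z => actionInCharts_one (F := F) (G := G) x)
    (hG.eventually_pullback_actionInCharts (F := F) x) ξ v

end Invariance

theorem tmul_ne_zero {R V W : Type*} [CommRing R] [IsDomain R] [AddCommGroup V] [Module R V]
    [Module.Projective R V] [AddCommGroup W] [Module R W] [Module.IsTorsionFree R W] {v : V} {w : W}
    (hv : v ≠ 0) (hw : w ≠ 0) : v ⊗ₜ[R] w ≠ 0 := by
  obtain ⟨φ, hφ⟩ := Module.Projective.exists_dual_ne_zero R hv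
  intro h
  have hsmul := congrArg (TensorProduct.lid R W ∘ φ.rTensor W) h
  simp only [Function.comp_apply, LinearMap.rTensor_tmul, TensorProduct.lid_tmul, map_zero] at hsmul
  exact smul_ne_zero hφ hw hsmul

section LieKernel

variable {L : Type*} [LieRing L] [LieAlgebra ℝ L]

theorem mem_lieH0 {R : Type*} [AddCommGroup R] [Module ℝ R] {ρ : L →ₗ[ℝ] Module.End ℝ R} {r : R} :
    r ∈ lieH0 ρ ↔ ∀ ξ, ρ ξ r = 0 :=
  LinearMap.mem_ker.trans LinearMap.ext_iff

theorem eq_top_of_lieH0_coadKernel_eq_bot {k : ℕ} (h : lieH0 (coadKernel (L := L) k) = ⊥)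
    {S : Submodule ℝ (lieKernel L k)} (hS : ∀ ξ p, adKernel k ξ p ∈ S) : S = ⊤ := by
  by_contra hne
  obtain ⟨c, hc, hle⟩ :=
    @Submodule.exists_le_ker_of_lt_top ℝ (lieKernel L k) _ _ _ S (Ne.lt_top hne)
  refine hc ((Submodule.eq_bot_iff _).1 h c (mem_lieH0.2 fun ξ => LinearMap.ext fun p => ?_))
  exact neg_eq_zero.2 (hle (hS ξ p))

theorem lieH0_eq_bot_of_tensorAction {R S : Type*} [AddCommGroup R] [Module ℝ R]
    [AddCommGroup S] [Module ℝ S] {ρ : L →ₗ[ℝ] Module.End ℝ R} {σ : L →ₗ[ℝ] Module.End ℝ S}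
    (h : lieH0 (tensorAction ρ σ) = ⊥) (hσ : lieH0 σ ≠ ⊥) : lieH0 ρ = ⊥ := by
  obtain ⟨s, hs, hs₀⟩ := (Submodule.ne_bot_iff _).1 hσ
  refine (Submodule.eq_bot_iff _).2 fun r hr => ?_
  by_contra hr₀
  have hinvariant : r ⊗ₜ[ℝ] s ∈ lieH0 (tensorAction ρ σ) := mem_lieH0.2 fun ξ => by
    change ρ ξ r ⊗ₜ[ℝ] s + r ⊗ₜ[ℝ] σ ξ s = 0
    rw [mem_lieH0.1 hr, mem_lieH0.1 hs, TensorProduct.zero_tmul, TensorProduct.tmul_zero, add_zero]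
  exact tmul_ne_zero hr₀ hs₀ ((Submodule.eq_bot_iff _).1 h _ hinvariant)

end LieKernel

/-- The operators of the Cartan calculus: contractions `ι_ξ` and a differential `d` on `V` such that
`L_ξ = d ι_ξ + ι_ξ d` satisfies `[L_ξ, ι_η] = -ι_[ξ, η]`. The sign is that of a left action on a
manifold, for which `ξ ↦ V_ξ` reverses brackets. Neither a grading nor `d ∘ d = 0` is required. -/
structure CartanCalculus (L V : Type*) [LieRing L] [LieAlgebra ℝ L] [AddCommGroup V]
    [Module ℝ V] where
  contraction : L →ₗ[ℝ] Module.End ℝ V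
  differential : Module.End ℝ V
  contraction_mul_self : ∀ ξ, contraction ξ * contraction ξ = 0
  lie_contraction : ∀ ξ η, ⁅differential * contraction ξ + contraction ξ * differential,
    contraction η⁆ = -contraction ⁅ξ, η⁆

namespace CartanCalculus

variable {L V : Type*} [LieRing L] [LieAlgebra ℝ L] [AddCommGroup V] [Module ℝ V]
  (C : CartanCalculus L V)

/-- The Lie derivative `L_ξ = d ι_ξ + ι_ξ d`. -/
def lieDeriv (ξ : L) : Module.End ℝ V :=
  C.differential * C.contraction ξ + C.contraction ξ * C.differential

/-- The contraction with elements of the exterior algebra, `ι_{ξ ∧ x} = ι_ξ ι_x`. For `k`-vectors it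
differs from the contraction `X ⌟ τ = τ(X, ⋯)` by the sign of the reversal of `k` letters. -/
def multiContraction : ExteriorAlgebra ℝ L →ₐ[ℝ] Module.End ℝ V :=
  ExteriorAlgebra.lift ℝ ⟨C.contraction, C.contraction_mul_self⟩

theorem multiContraction_algebraMap (r : ℝ) (a : V) :
    C.multiContraction (algebraMap ℝ _ r) a = r • a := by
  rw [AlgHom.commutes, Module.algebraMap_end_apply]

theorem multiContraction_ι_mul (ξ : L) (x : ExteriorAlgebra ℝ L) (a : V) :
    C.multiContraction (ExteriorAlgebra.ι ℝ ξ * x) a =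
      C.contraction ξ (C.multiContraction x a) := by
  rw [map_mul, multiContraction, ExteriorAlgebra.lift_ι_apply, Module.End.mul_apply]

theorem lieDeriv_contraction (ξ η : L) (a : V) :
    C.lieDeriv ξ (C.contraction η a) =
      C.contraction η (C.lieDeriv ξ a) - C.contraction ⁅ξ, η⁆ a := by
  have h := LinearMap.congr_fun (C.lie_contraction ξ η) a
  rw [← lieDeriv, Ring.lie_def, LinearMap.sub_apply, LinearMap.neg_apply] at h
  rw [sub_eq_add_neg, ← h]
  exact (add_sub_cancel _ _).symm

theorem lieDeriv_multiContraction (ξ : L) (x : ExteriorAlgebra ℝ L) (a : V) :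
    C.lieDeriv ξ (C.multiContraction x a) =
      C.multiContraction x (C.lieDeriv ξ a) - C.multiContraction (adExt ξ x) a := by
  induction x using exteriorAlgebra_left_induction with
  | algebraMap r =>
    rw [adExt_algebraMap, map_zero, LinearMap.zero_apply, sub_zero, multiContraction_algebraMap,
      multiContraction_algebraMap, map_smul]
  | add x y hx hy =>
    simp only [map_add, LinearMap.add_apply, hx, hy]
    abel
  | ι_mul x η hx =>
    rw [adExt_ι_mul, map_add, LinearMap.add_apply]
    simp only [multiContraction_ι_mul, lieDeriv_contraction, hx, map_sub]
    abel

variable {C} {a : V}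

theorem differential_multiContraction (hd : C.differential a = 0)
    (hL : ∀ ξ, C.lieDeriv ξ a = 0) (x : ExteriorAlgebra ℝ L) :
    C.differential (C.multiContraction x a) = C.multiContraction (ceDiff x) a := by
  induction x using exteriorAlgebra_left_induction with
  | algebraMap r =>
    rw [ceDiff_algebraMap, map_zero, LinearMap.zero_apply, multiContraction_algebraMap, map_smul,
      hd, smul_zero]
  | add x y hx hy => simp only [map_add, LinearMap.add_apply, hx, hy]
  | ι_mul x η hx =>
    have hcartan : C.differential (C.contraction η (C.multiContraction x a)) +
        C.contraction η (C.differential (C.multiContraction x a)) =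
          -C.multiContraction (adExt η x) a := by
      rw [← zero_sub, ← map_zero (C.multiContraction x), ← hL η, ← lieDeriv_multiContraction]
      rfl
    rw [multiContraction_ι_mul, ceDiff_ι_mul, map_sub, LinearMap.sub_apply, map_neg,
      LinearMap.neg_apply, multiContraction_ι_mul, ← hx, eq_sub_of_add_eq hcartan]
    abel

theorem differential_contraction_multiContraction (hd : C.differential a = 0)
    (hL : ∀ ξ, C.lieDeriv ξ a = 0) (ξ : L) {x : ExteriorAlgebra ℝ L} (hx : ceDiff x = 0) :
    C.differential (C.contraction ξ (C.multiContraction x a)) =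
      -C.multiContraction (adExt ξ x) a := by
  have hcartan := C.lieDeriv_multiContraction ξ x a
  rw [hL, map_zero, zero_sub] at hcartan
  rw [← hcartan, lieDeriv, LinearMap.add_apply, Module.End.mul_apply, Module.End.mul_apply,
    differential_multiContraction hd hL, hx, map_zero, LinearMap.zero_apply, map_zero, add_zero]

theorem multiContraction_mem_range_differential {k : ℕ}
    (h : lieH0 (coadKernel (L := L) k) = ⊥) (hd : C.differential a = 0)
    (hL : ∀ ξ, C.lieDeriv ξ a = 0) (p : lieKernel L k) :
    C.multiContraction p.1 a ∈ LinearMap.range C.differential := by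
  let contractions : lieKernel L k →ₗ[ℝ] V := C.multiContraction.toLinearMap.flip a ∘ₗ
    (⋀[ℝ]^k L).subtype ∘ₗ (lieKernel L k).subtype
  have htop : (LinearMap.range C.differential).comap contractions = ⊤ := by
    refine eq_top_of_lieH0_coadKernel_eq_bot h fun ξ p => ?_
    refine ⟨-C.contraction ξ (C.multiContraction p.1 a), ?_⟩
    rw [map_neg]
    exact neg_eq_iff_eq_neg.2 (differential_contraction_multiContraction hd hL ξ p.2)
  exact Submodule.mem_comap.1 (htop.ge Submodule.mem_top)

end CartanCalculus

section TotalForm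

variable {E : Type*} [NormedAddCommGroup E] [NormedSpace ℝ E]
  {M : Type*} [TopologicalSpace M] [ChartedSpace E M] [IsManifold 𝓘(ℝ, E) ∞ M]

variable (E M) in
/-- Families of forms, one of each degree. The direct sum `Ω^•(M)` would do as well; the product
has definitionally transparent components. -/
abbrev TotalForm : Type _ := ∀ k : ℕ, DiffForm E M k

/-- The interior product on families of forms. -/
def totalInterior : VField E M →ₗ[ℝ] Module.End ℝ (TotalForm E M) :=
  LinearMap.mk₂ ℝ (fun X a k => interior k X (a (k + 1)))
    (fun X Y a => funext fun k => by rw [map_add, LinearMap.add_apply]; rfl)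
    (fun c X a => funext fun k => by rw [map_smul, LinearMap.smul_apply]; rfl)
    (fun X a b => funext fun k => map_add (interior k X) (a (k + 1)) (b (k + 1)))
    (fun c X a => funext fun k => map_smul (interior k X) c (a (k + 1)))

variable (E M) in
/-- The exterior derivative on families of forms. -/
def totalExtDer : Module.End ℝ (TotalForm E M) :=
  LinearMap.pi fun k => match k with
    | 0 => 0
    | k + 1 => extDer k ∘ₗ LinearMap.proj k

theorem totalExtDer_apply_succ (a : TotalForm E M) (k : ℕ) :
    totalExtDer E M a (k + 1) = extDer k (a k) := rfl

theorem totalInterior_mul_self (X : VField E M) :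
    totalInterior X * totalInterior X = (0 : Module.End ℝ (TotalForm E M)) :=
  LinearMap.ext fun a => funext fun k => interior_interior_self X (a (k + 2))

/-- The Lie derivative on families of forms. -/
def totalLieDer (X : VField E M) : Module.End ℝ (TotalForm E M) :=
  LinearMap.pi fun k => lieDer k X ∘ₗ LinearMap.proj k

theorem totalLieDer_apply (X : VField E M) (a : TotalForm E M) (k : ℕ) :
    totalLieDer X a k = lieDer k X (a k) := rfl

theorem totalLieDer_eq (X : VField E M) :
    totalLieDer X = totalExtDer E M * totalInterior X + totalInterior X * totalExtDer E M := by
  refine LinearMap.ext fun a => funext fun k => ?_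
  cases k with
  | zero => exact (zero_add (interior 0 X (extDer 0 (a 0)))).symm
  | succ k => rfl

theorem totalExtDer_single {k : ℕ} {Ω : DiffForm E M k} (h : extDer k Ω = 0) :
    totalExtDer E M (Pi.single k Ω) = 0 := by
  funext l
  cases l with
  | zero => rfl
  | succ l =>
    rw [totalExtDer_apply_succ]
    rcases eq_or_ne l k with rfl | hl
    · rw [Pi.single_eq_same, h]
      rfl
    · rw [Pi.single_eq_of_ne hl, map_zero]
      rfl

theorem totalLieDer_single {k : ℕ} {Ω : DiffForm E M k} {X : VField E M}
    (h : lieDer k X Ω = 0) : totalLieDer X (Pi.single k Ω) = 0 := by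
  funext l
  rw [totalLieDer_apply]
  rcases eq_or_ne l k with rfl | hl
  · rw [Pi.single_eq_same, h]
    rfl
  · rw [Pi.single_eq_of_ne hl, map_zero]
    rfl

end TotalForm

section Action

variable {E : Type*} [NormedAddCommGroup E] [NormedSpace ℝ E]
  {M : Type*} [TopologicalSpace M] [ChartedSpace E M] [IsManifold 𝓘(ℝ, E) ∞ M]
  {F : Type*} [NormedAddCommGroup F] [NormedSpace ℝ F]
  {G : Type*} [TopologicalSpace G] [ChartedSpace F G] [Group G] [LieGroup 𝓘(ℝ, F) ∞ G]
  [MulAction G M] [ContMDiffSMul 𝓘(ℝ, F) 𝓘(ℝ, E) ∞ G M] [CompleteSpace E] [CompleteSpace F]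

variable (E M F G) in
/-- The Cartan calculus of a smooth action: `ξ` acts on families of forms by the interior product
with `V_ξ`. -/
def actionCalculus : CartanCalculus (GroupLieAlgebra 𝓘(ℝ, F) G) (TotalForm E M) where
  contraction := totalInterior ∘ₗ infGen E M F G
  differential := totalExtDer E M
  contraction_mul_self ξ := totalInterior_mul_self (infGen E M F G ξ)
  lie_contraction ξ η := by
    refine LinearMap.ext fun a => funext fun k => ?_
    rw [LinearMap.comp_apply, ← totalLieDer_eq]
    refine sub_eq_of_eq_add' ((lieDer_interior (a (k + 1)) (mlieBracket_infGen ξ η)).trans ?_)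
    rw [map_neg, map_neg, LinearMap.neg_apply]
    rfl

theorem actionCalculus_lieDeriv (ξ : GroupLieAlgebra 𝓘(ℝ, F) G) :
    (actionCalculus E M F G).lieDeriv ξ = totalLieDer (infGen E M F G ξ) :=
  (totalLieDer_eq (infGen E M F G ξ)).symm

end Action

section Reversal

variable {V : Type*} [AddCommGroup V] [Module ℝ V] [TopologicalSpace V] {k l N : ℕ}

theorem contract_ιMulti (h : k + l = N) (τ : V [⋀^Fin N]→L[ℝ] ℝ) (X : Fin k → V) :
    contract h τ (exteriorPower.ιMulti ℝ k X) = contractVec h τ X :=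
  exteriorPower.alternatingMapLinearEquiv_apply_ιMulti _ X

/-- The sign of the order reversing permutation of `k` letters. -/
def revSign (k : ℕ) : ℝ := ((Equiv.Perm.sign (Fin.revPerm : Equiv.Perm (Fin k)) : ℤˣ) : ℤ)

theorem revSign_mul_self (k : ℕ) : revSign k * revSign k = 1 := by
  rw [revSign, ← Int.cast_mul, ← Units.val_mul, Int.units_mul_self, Units.val_one, Int.cast_one]

theorem contractVec_rev (h : k + l = N) (τ : V [⋀^Fin N]→L[ℝ] ℝ) (X : Fin k → V) :
    contractVec h τ (fun i => X i.rev) = revSign k • contractVec h τ X := by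
  have hrev : exteriorPower.ιMulti ℝ k (fun i => X i.rev) =
      revSign k • exteriorPower.ιMulti ℝ k X := by
    refine ((exteriorPower.ιMulti ℝ k).map_perm X Fin.revPerm).trans ?_
    rw [Units.smul_def, ← Int.cast_smul_eq_zsmul ℝ, revSign]
  rw [← contract_ιMulti, ← contract_ιMulti, hrev, map_smul]

end Reversal

section MultiContraction

variable {E : Type*} [NormedAddCommGroup E] [NormedSpace ℝ E] [CompleteSpace E]
  {M : Type*} [TopologicalSpace M] [ChartedSpace E M] [IsManifold 𝓘(ℝ, E) ∞ M]
  {F : Type*} [NormedAddCommGroup F] [NormedSpace ℝ F] [CompleteSpace F]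
  {G : Type*} [TopologicalSpace G] [ChartedSpace F G] [Group G] [LieGroup 𝓘(ℝ, F) ∞ G]
  [MulAction G M] [ContMDiffSMul 𝓘(ℝ, F) 𝓘(ℝ, E) ∞ G M]

theorem multiContraction_ιMulti_apply (k : ℕ) {l N : ℕ} (h : k + l = N)
    (ξ : Fin k → GroupLieAlgebra 𝓘(ℝ, F) G) (a : TotalForm E M) (x : M) :
    ((actionCalculus E M F G).multiContraction (ExteriorAlgebra.ιMulti ℝ k ξ) a l).1 x =
      contractVec h ((a N).1 x) (fun i => infGenAt E F G x (ξ i.rev)) := by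
  induction k generalizing l with
  | zero =>
    obtain rfl : l = N := by omega
    rw [ExteriorAlgebra.ιMulti_zero_apply, map_one]
    ext Y
    refine congrArg ((a l).1 x) ?_
    ext j
    simp [Fin.append, Fin.addCases]
  | succ k ih =>
    have hrev : (fun i : Fin (k + 1) => infGenAt E F G x (ξ i.rev)) =
        Fin.snoc (fun i : Fin k => infGenAt E F G x (Matrix.vecTail ξ i.rev))
          (infGenAt E F G x (ξ 0)) := by
      funext i
      induction i using Fin.lastCases with
      | last => simp
      | cast i => simp [Matrix.vecTail, Fin.rev_castSucc]
    rw [ExteriorAlgebra.ιMulti_succ_apply, CartanCalculus.multiContraction_ι_mul, hrev]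
    ext Y
    refine (congrArg (fun τ => τ (Matrix.vecCons (infGenAt E F G x (ξ 0)) Y))
      (ih (l := l + 1) (by omega) (Matrix.vecTail ξ))).trans (congrArg ((a N).1 x) ?_)
    rw [Fin.append_left_snoc]
    rfl

theorem multiContraction_apply {k l N : ℕ} (h : k + l = N)
    (p : ⋀[ℝ]^k (GroupLieAlgebra 𝓘(ℝ, F) G)) (a : TotalForm E M) (x : M) :
    ((actionCalculus E M F G).multiContraction p a l).1 x =
      revSign k • contract h ((a N).1 x) (genMultivector p x) := by
  have hp : p ∈ Submodule.span ℝ (Set.range (exteriorPower.ιMulti ℝ k)) :=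
    (exteriorPower.ιMulti_span ℝ k _).ge Submodule.mem_top
  induction hp using Submodule.span_induction with
  | mem p h' =>
    obtain ⟨ξ, rfl⟩ := h'
    rw [genMultivector, exteriorPower.map_apply_ιMulti, contract_ιMulti, ← contractVec_rev]
    exact multiContraction_ιMulti_apply k h ξ a x
  | zero =>
    rw [genMultivector, map_zero, map_zero, smul_zero, Submodule.coe_zero, map_zero]
    rfl
  | add p q _ _ hp hq =>
    rw [genMultivector] at *
    rw [map_add, map_add, smul_add, ← hp, ← hq, Submodule.coe_add, map_add]
    rfl
  | smul c p _ hp =>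
    rw [genMultivector] at *
    rw [map_smul, map_smul, smul_comm, ← hp, Submodule.coe_smul, map_smul]
    rfl

end MultiContraction

section Smoothness

theorem contDiff_multilinearMap {𝕜 ι E V : Type*} [NontriviallyNormedField 𝕜] [CompleteSpace 𝕜]
    [Fintype ι] [NormedAddCommGroup E] [NormedSpace 𝕜 E] [FiniteDimensional 𝕜 E]
    [NormedAddCommGroup V] [NormedSpace 𝕜 V] (A : MultilinearMap 𝕜 (fun _ : ι => E) V)
    {n : WithTop ℕ∞} : ContDiff 𝕜 n A := by
  classical
  let b := Module.finBasis 𝕜 E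
  have hexpand (v : ι → E) :
      A v = ∑ r : ι → Fin (Module.finrank 𝕜 E), (∏ i, b.coord (r i) (v i)) • A (b ∘ r) := by
    conv_lhs => rw [show v = fun i => ∑ j, b.repr (v i) j • b j from
      funext fun i => (b.sum_repr (v i)).symm]
    rw [MultilinearMap.map_sum]
    exact Finset.sum_congr rfl fun r _ => A.map_smul_univ _ _
  have hcoord (r : ι → Fin (Module.finrank 𝕜 E)) (i : ι) :
      ContDiff 𝕜 n fun v : ι → E => b.coord (r i) (v i) :=
    (LinearMap.toContinuousLinearMap (b.coord (r i))).contDiff.comp (contDiff_apply 𝕜 E i)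
  rw [show (A : (ι → E) → V) = _ from funext hexpand]
  exact ContDiff.sum fun r _ => (contDiff_prod fun i _ => hcoord r i).smul contDiff_const

variable {E : Type*} [NormedAddCommGroup E] [NormedSpace ℝ E]
  {M : Type*} [TopologicalSpace M] [ChartedSpace E M] [IsManifold 𝓘(ℝ, E) ∞ M]
  {F : Type*} [NormedAddCommGroup F] [NormedSpace ℝ F]
  {G : Type*} [TopologicalSpace G] [ChartedSpace F G] [Group G] [LieGroup 𝓘(ℝ, F) ∞ G]
  [MulAction G M] [ContMDiffSMul 𝓘(ℝ, F) 𝓘(ℝ, E) ∞ G M]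

theorem isSmoothMultivectorField_genMultivector [FiniteDimensional ℝ E] {k : ℕ}
    (p : ⋀[ℝ]^k (GroupLieAlgebra 𝓘(ℝ, F) G)) :
    IsSmoothMultivectorField (fun x : M => genMultivector (E := E) p x) := by
  intro x₀ ℓ
  have hp : p ∈ Submodule.span ℝ (Set.range (exteriorPower.ιMulti ℝ k)) :=
    (exteriorPower.ιMulti_span ℝ k _).ge Submodule.mem_top
  induction hp using Submodule.span_induction with
  | mem p h' =>
    obtain ⟨ξ, rfl⟩ := h'
    simp only [genMultivector, exteriorPower.map_apply_ιMulti]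
    exact (contDiff_multilinearMap
      (ℓ.compAlternatingMap (exteriorPower.ιMulti ℝ k (M := E))).toMultilinearMap).comp_contDiffOn
      (contDiffOn_pi.2 fun i => contDiffOn_vectorField (infGen E M F G (ξ i)) x₀)
  | zero =>
    simp only [genMultivector, map_zero]
    exact contDiffOn_const
  | add p q _ _ hp hq =>
    simp only [genMultivector, map_add] at hp hq ⊢
    exact hp.add hq
  | smul c p _ hp =>
    simp only [genMultivector, map_smul] at hp ⊢
    exact (contDiffOn_const (c := c)).smul hp

end Smoothness

section Existence

theorem exists_comp_eq_of_forall_mem_range {K U V W : Type*} [DivisionRing K]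
    [AddCommGroup U] [Module K U] [AddCommGroup V] [Module K V] [AddCommGroup W] [Module K W]
    {f : V →ₗ[K] W} {g : U →ₗ[K] W} (h : ∀ u, g u ∈ LinearMap.range f) :
    ∃ s : U →ₗ[K] V, f ∘ₗ s = g := by
  obtain ⟨s, hs⟩ := Module.projective_lifting_property f.rangeRestrict (g.codRestrict _ h)
    f.surjective_rangeRestrict
  exact ⟨s, LinearMap.ext fun u => congrArg Subtype.val (LinearMap.congr_fun hs u)⟩

variable {E : Type*} [NormedAddCommGroup E] [NormedSpace ℝ E] [FiniteDimensional ℝ E]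
  {M : Type*} [TopologicalSpace M] [ChartedSpace E M] [IsManifold 𝓘(ℝ, E) ∞ M]
  {F : Type*} [NormedAddCommGroup F] [NormedSpace ℝ F] [FiniteDimensional ℝ F]
  {G : Type*} [TopologicalSpace G] [ChartedSpace F G] [Group G] [LieGroup 𝓘(ℝ, F) ∞ G]
  [MulAction G M] [ContMDiffSMul 𝓘(ℝ, F) 𝓘(ℝ, E) ∞ G M]
  {n : ℕ} {Ω : DiffForm E M (n + 1)} {k : ℕ}

theorem isWeakMomentComponent_of_extDer_eq (hk : k ≤ n)
    {f : lieKernel (GroupLieAlgebra 𝓘(ℝ, F) G) k →ₗ[ℝ] DiffForm E M (n - k)}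
    (hf : ∀ p x, (extDer (n - k) (f p)).1 x =
      -(zetaSign k • contract (show k + (n - k + 1) = n + 1 by omega) (Ω.1 x)
        (genMultivector p.1 x))) :
    IsWeakMomentComponent Ω k hk f where
  hamiltonian p := ⟨genMultivector (zetaSign k • p.1), isSmoothMultivectorField_genMultivector _,
    fun x => by rw [hf]; simp only [genMultivector, map_smul]⟩
  extDer_eq := hf

theorem exists_extDer_eq_multiContraction (hΩ : extDer (n + 1) Ω = 0)
    (hinv : ∀ ξ, lieDer (n + 1) (infGen E M F G ξ) Ω = 0)
    (h : lieH0 (coadKernel (L := GroupLieAlgebra 𝓘(ℝ, F) G) k) = ⊥) (l : ℕ) :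
    ∃ f : lieKernel (GroupLieAlgebra 𝓘(ℝ, F) G) k →ₗ[ℝ] DiffForm E M l, ∀ p,
      extDer l (f p) =
        (actionCalculus E M F G).multiContraction p.1 (Pi.single (n + 1) Ω) (l + 1) := by
  have : CompleteSpace E := FiniteDimensional.complete ℝ E
  have : CompleteSpace F := FiniteDimensional.complete ℝ F
  let contractions : lieKernel (GroupLieAlgebra 𝓘(ℝ, F) G) k →ₗ[ℝ] DiffForm E M (l + 1) :=
    LinearMap.proj (l + 1) ∘ₗ
      (actionCalculus E M F G).multiContraction.toLinearMap.flip (Pi.single (n + 1) Ω) ∘ₗ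
        (⋀[ℝ]^k (GroupLieAlgebra 𝓘(ℝ, F) G)).subtype ∘ₗ (lieKernel _ k).subtype
  have hexact (p) : contractions p ∈ LinearMap.range (extDer (E := E) (M := M) l) := by
    obtain ⟨b, hb⟩ := CartanCalculus.multiContraction_mem_range_differential
      (C := actionCalculus E M F G) h (totalExtDer_single hΩ) (fun ξ => by
        rw [actionCalculus_lieDeriv, totalLieDer_single (hinv ξ)]) p
    exact ⟨b l, congrFun hb (l + 1)⟩
  obtain ⟨f, hf⟩ := exists_comp_eq_of_forall_mem_range
    (U := lieKernel (GroupLieAlgebra 𝓘(ℝ, F) G) k) hexact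
  exact ⟨f, LinearMap.congr_fun hf⟩

theorem exists_isWeakMomentComponent (hΩ : extDer (n + 1) Ω = 0)
    (hinv : ∀ ξ, lieDer (n + 1) (infGen E M F G ξ) Ω = 0) (hk : k ≤ n)
    (h : lieH0 (coadKernel (L := GroupLieAlgebra 𝓘(ℝ, F) G) k) = ⊥) :
    ∃ f : lieKernel (GroupLieAlgebra 𝓘(ℝ, F) G) k →ₗ[ℝ] DiffForm E M (n - k),
      IsWeakMomentComponent Ω k hk f := by
  have : CompleteSpace E := FiniteDimensional.complete ℝ E
  have : CompleteSpace F := FiniteDimensional.complete ℝ F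
  have hN : k + (n - k + 1) = n + 1 := by omega
  obtain ⟨f, hf⟩ := exists_extDer_eq_multiContraction hΩ hinv h (n - k)
  refine ⟨-(zetaSign k * revSign k) • f, isWeakMomentComponent_of_extDer_eq hk fun p x => ?_⟩
  have hcontract : (extDer (n - k) (f p)).1 x =
      revSign k • contract hN (Ω.1 x) (genMultivector p.1 x) := by
    rw [hf, multiContraction_apply hN, Pi.single_eq_same]
  rw [LinearMap.smul_apply, map_smul]
  change -(zetaSign k * revSign k) • (extDer (n - k) (f p)).1 x = _
  rw [hcontract, smul_smul, neg_mul, mul_assoc, revSign_mul_self, mul_one]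
  exact neg_smul (zetaSign k) (contract hN (Ω.1 x) (genMultivector p.1 x))

end Existence

end Multisymplectic

end

theorem mainTheorem1_general
    {E : Type*} [NormedAddCommGroup E] [NormedSpace ℝ E] [FiniteDimensional ℝ E]
    {M : Type*} [TopologicalSpace M] [ChartedSpace E M] [IsManifold 𝓘(ℝ, E) ∞ M]
    {F : Type*} [NormedAddCommGroup F] [NormedSpace ℝ F] [FiniteDimensional ℝ F]
    {G : Type*} [TopologicalSpace G] [ChartedSpace F G] [Group G] [LieGroup 𝓘(ℝ, F) ∞ G]
    [MulAction G M] [ContMDiffSMul 𝓘(ℝ, F) 𝓘(ℝ, E) ∞ G M]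
    {n : ℕ} {Ω : DiffForm E M (n + 1)} (hΩ : extDer (n + 1) Ω = 0)
    (hinv : ∀ ξ, lieDer (n + 1) (infGen E M F G ξ) Ω = 0) :
    (∀ (k : ℕ) (_ : 1 ≤ k) (hk : k ≤ n),
      lieH0 (coadKernel (L := GroupLieAlgebra 𝓘(ℝ, F) G) k) = ⊥ →
      ∃ f : lieKernel (GroupLieAlgebra 𝓘(ℝ, F) G) k →ₗ[ℝ] DiffForm E M (n - k),
        IsWeakMomentComponent Ω k hk f) ∧
    ((∀ k : ℕ, 1 ≤ k → k ≤ n →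
      lieH0 (coadKernel (L := GroupLieAlgebra 𝓘(ℝ, F) G) k) = ⊥) →
      ∃ f : ∀ k : ℕ, 1 ≤ k → k ≤ n →
          (lieKernel (GroupLieAlgebra 𝓘(ℝ, F) G) k →ₗ[ℝ] DiffForm E M (n - k)),
        IsWeakMomentMap Ω f) ∧
    (∀ (k : ℕ) (_ : 1 ≤ k) (hk : k ≤ n),
      lieH0 (tensorAction (coadKernel (L := GroupLieAlgebra 𝓘(ℝ, F) G) k)
        (closedFormAction E M F G (n - k))) = ⊥ →
      lieH0 (closedFormAction E M F G (n - k)) ≠ ⊥ →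
      ∃ f : lieKernel (GroupLieAlgebra 𝓘(ℝ, F) G) k →ₗ[ℝ] DiffForm E M (n - k),
        IsWeakMomentComponent Ω k hk f) ∧
    ((∀ k : ℕ, 1 ≤ k → k ≤ n →
      lieH0 (tensorAction (coadKernel (L := GroupLieAlgebra 𝓘(ℝ, F) G) k)
        (closedFormAction E M F G (n - k))) = ⊥ ∧
      lieH0 (closedFormAction E M F G (n - k)) ≠ ⊥) →
      ∃ f : ∀ k : ℕ, 1 ≤ k → k ≤ n →
          (lieKernel (GroupLieAlgebra 𝓘(ℝ, F) G) k →ₗ[ℝ] DiffForm E M (n - k)),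
        IsWeakMomentMap Ω f) := by
  have exists_component (k : ℕ) (hk : k ≤ n)
      (h : lieH0 (coadKernel (L := GroupLieAlgebra 𝓘(ℝ, F) G) k) = ⊥) :
      ∃ f : lieKernel (GroupLieAlgebra 𝓘(ℝ, F) G) k →ₗ[ℝ] DiffForm E M (n - k),
        IsWeakMomentComponent Ω k hk f :=
    exists_isWeakMomentComponent hΩ hinv hk h
  refine ⟨fun k _ hk h => exists_component k hk h, fun h => ?_,
    fun k _ hk h h' => exists_component k hk (lieH0_eq_bot_of_tensorAction h h'), fun h => ?_⟩
  · choose f hf using fun k hk₁ hk => exists_component k hk (h k hk₁ hk)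
    exact ⟨f, hf⟩
  · choose f hf using fun k hk₁ hk =>
      exists_component k hk (lieH0_eq_bot_of_tensorAction (h k hk₁ hk).1 (h k hk₁ hk).2)
    exact ⟨f, hf⟩

theorem mainTheorem1
    {E : Type*} [NormedAddCommGroup E] [NormedSpace ℝ E] [FiniteDimensional ℝ E]
    {M : Type*} [TopologicalSpace M] [T2Space M] [SecondCountableTopology M]
    [ChartedSpace E M] [IsManifold 𝓘(ℝ, E) ∞ M]
    {F : Type*} [NormedAddCommGroup F] [NormedSpace ℝ F] [FiniteDimensional ℝ F]
    {G : Type*} [TopologicalSpace G] [ConnectedSpace G] [ChartedSpace F G] [Group G]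
    [LieGroup 𝓘(ℝ, F) ∞ G]
    [MulAction G M] [ContMDiffSMul 𝓘(ℝ, F) 𝓘(ℝ, E) ∞ G M]
    (n : ℕ) (hn : 1 ≤ n) (Ω : DiffForm E M (n + 1)) (hΩ : IsPlectic Ω)
    (hG : PreservesForm G Ω) :
    (∀ (k : ℕ) (_ : 1 ≤ k) (hk : k ≤ n),
      lieH0 (coadKernel (L := GroupLieAlgebra 𝓘(ℝ, F) G) k) = ⊥ →
      ∃ f : lieKernel (GroupLieAlgebra 𝓘(ℝ, F) G) k →ₗ[ℝ] DiffForm E M (n - k),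
        IsWeakMomentComponent Ω k hk f) ∧
    ((∀ k : ℕ, 1 ≤ k → k ≤ n →
      lieH0 (coadKernel (L := GroupLieAlgebra 𝓘(ℝ, F) G) k) = ⊥) →
      ∃ f : ∀ k : ℕ, 1 ≤ k → k ≤ n →
          (lieKernel (GroupLieAlgebra 𝓘(ℝ, F) G) k →ₗ[ℝ] DiffForm E M (n - k)),
        IsWeakMomentMap Ω f) ∧
    (∀ (k : ℕ) (_ : 1 ≤ k) (hk : k ≤ n),
      lieH0 (tensorAction (coadKernel (L := GroupLieAlgebra 𝓘(ℝ, F) G) k)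
        (closedFormAction E M F G (n - k))) = ⊥ →
      lieH0 (closedFormAction E M F G (n - k)) ≠ ⊥ →
      ∃ f : lieKernel (GroupLieAlgebra 𝓘(ℝ, F) G) k →ₗ[ℝ] DiffForm E M (n - k),
        IsWeakMomentComponent Ω k hk f) ∧
    ((∀ k : ℕ, 1 ≤ k → k ≤ n →
      lieH0 (tensorAction (coadKernel (L := GroupLieAlgebra 𝓘(ℝ, F) G) k)
        (closedFormAction E M F G (n - k))) = ⊥ ∧
      lieH0 (closedFormAction E M F G (n - k)) ≠ ⊥) →
      ∃ f : ∀ k : ℕ, 1 ≤ k → k ≤ n →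
          (lieKernel (GroupLieAlgebra 𝓘(ℝ, F) G) k →ₗ[ℝ] DiffForm E M (n - k)),
        IsWeakMomentMap Ω f) := by
  exact mainTheorem1_general hΩ.closed (lieDer_infGen_eq_zero (F := F) hG)
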